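/- Let $M$ be a connected smooth $m$-dimensional manifold and $f\colon M\to\mathbb{R}^n$ a smooth immersion, so that $M$ is an immersed submanifold of $\mathbb{R}^n$ with tangent spaces $T_pM:=df_p(T_pM)\subset\mathbb{R}^n$. Let $d\in\mathbb{R}^n$, $d\neq 0$, and let $d^\top$ denote the orthogonal projection of $d$ to $T_pM$. Assume that 1. $M$ is a helix with respect to $d$: the angle $\theta(p)\in[0,\pi/2]$ between $d$ and $T_pM$ (so $\|d^\top\|=\|d\|\cos\theta(p)$) does not depend on $p\in M$; 2. $M$ is ruled: $f$ maps every integral curve in $M$ of the vector field $T=d^\top/\|d^\top\|$ to a geodesic (straight line segment) of $\mathbb{R}^n$ (if $d^\top=0$, this condition is void); 3. $M$ is minimal: its mean curvature vector, the trace of the second fundamental form with respect to the induced metric, vanishes identically; 4. $M$ is full: $f(M)$ is not contained in any affine hyperplane of $\mathbb{R}^n$. Then $d$ is tangent to $M$, that is, $d\in T_pM$ for every $p\in M$. In particular the helix angle $\theta$ is $0$, and $M$ is (locally) a cylinder over a minimal submanifold of the hyperplane $H=\{x:\langle x,d\rangle=0\}$: every $p\in M$ has an open neighbourhood $U\subset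 M$ such that $f|_U$ is a topological embedding and $$f(U)=\{\,q+t\,d : q\in N,\ a<t<b\,\}$$ for some real numbers $a<b$ and some $(m-1)$-dimensional embedded minimal submanifold $N\subset H$ of $\mathbb{R}^n$. -/

import Mathlib

open Set Topology TopologicalSpace Manifold ContDiff RealInnerProductSpace

namespace MinimalHelix

/-- Euclidean space `ℝⁿ`. -/
abbrev Euc (n : ℕ) : Type := EuclideanSpace ℝ (Fin n)

section Parametrized

variable {m n : ℕ}

/-- The `i`-th partial derivative `∂ᵢu(x)` of a map `u : ℝᵐ → ℝⁿ`. -/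
noncomputable def pd (u : Euc m → Euc n) (x : Euc m) (i : Fin m) : Euc n :=
  fderiv ℝ u x (EuclideanSpace.single i 1)

/-- The matrix `gᵢⱼ = ⟪∂ᵢu, ∂ⱼu⟫` of the metric induced by a parametrization `u`. -/
noncomputable def firstForm (u : Euc m → Euc n) (x : Euc m) : Matrix (Fin m) (Fin m) ℝ :=
  Matrix.of fun i j => ⟪pd u x i, pd u x j⟫

/-- The second fundamental form `α(∂ᵢ, ∂ⱼ) = (∂ᵢ∂ⱼu)^⊥` of a parametrization `u`: the component
of the second derivative orthogonal to the tangent space, the range of `du(x)`. -/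
noncomputable def secondForm (u : Euc m → Euc n) (x : Euc m) (i j : Fin m) : Euc n :=
  (LinearMap.range (fderiv ℝ u x).toLinearMap)ᗮ.starProjection
    (fderiv ℝ (fun y => pd u y j) x (EuclideanSpace.single i 1))

/-- The mean curvature vector `∑ gⁱʲ α(∂ᵢ, ∂ⱼ)` of a parametrization `u`, i.e. the trace of the
second fundamental form with respect to the induced metric. -/
noncomputable def meanCurvature (u : Euc m → Euc n) (x : Euc m) : Euc n :=
  ∑ i, ∑ j, (firstForm u x)⁻¹ i j • secondForm u x i j

end Parametrized

section Immersed

variable (m : ℕ) {n : ℕ} {M : Type*} [TopologicalSpace M] [ChartedSpace (Euc m) M]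

/-- The differential of `f : M → ℝⁿ` at `p`, as a map into `ℝⁿ`. -/
noncomputable def differential (f : M → Euc n) (p : M) :
    TangentSpace (𝓡 m) p →L[ℝ] Euc n :=
  mfderiv (𝓡 m) 𝓘(ℝ, Euc n) f p

/-- `f : M → ℝⁿ` is a smooth immersion, i.e. it makes `M` an immersed submanifold of `ℝⁿ`. -/
def IsSmoothImmersion (f : M → Euc n) : Prop :=
  ContMDiff (𝓡 m) 𝓘(ℝ, Euc n) ∞ f ∧ ∀ p : M, Function.Injective (differential m f p)

/-- The tangent space of the immersed submanifold `f : M → ℝⁿ` at `p`, as a subspace of `ℝⁿ`. -/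
noncomputable def tangentPlane (f : M → Euc n) (p : M) : Submodule ℝ (Euc n) :=
  LinearMap.range (differential m f p).toLinearMap

/-- The component `d^⊤` of `d` tangent to the immersed submanifold at `p`. -/
noncomputable def tangentPart (f : M → Euc n) (d : Euc n) (p : M) : Euc n :=
  (tangentPlane m f p).starProjection d

/-- The angle in `[0, π/2]` between `d` and the tangent space at `p`, i.e. the angle between `d`
and its orthogonal projection `d^⊤` to the tangent space (`π/2` if `d^⊤ = 0`). -/
noncomputable def helixAngle (f : M → Euc n) (d : Euc n) (p : M) : ℝ :=
  InnerProductGeometry.angle d (tangentPart m f d p)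

/-- `f : M → ℝⁿ` is a helix with respect to `d`: the angle between `d` and the tangent spaces
is constant. -/
def IsHelix (f : M → Euc n) (d : Euc n) : Prop :=
  ∃ θ : ℝ, ∀ p : M, helixAngle m f d p = θ

/-- The vector field `T = d^⊤ / ‖d^⊤‖`, as a tangent vector field on `M` (it is `0` at points where
`d^⊤ = 0`). -/
noncomputable def unitField (f : M → Euc n) (d : Euc n) (p : M) : TangentSpace (𝓡 m) p :=
  (differential m f p).toLinearMap.leftInverse
    (‖tangentPart m f d p‖⁻¹ • tangentPart m f d p)

/-- The helix is ruled: every integral curve of `T` is a geodesic of `ℝⁿ`, that is, an affinely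
parametrized straight line segment. -/
def IsRuled (f : M → Euc n) (d : Euc n) : Prop :=
  ∀ (γ : ℝ → M) (a b : ℝ), IsMIntegralCurveOn γ (unitField m f d) (Ioo a b) →
    ∃ c v : Euc n, ∀ t ∈ Ioo a b, f (γ t) = c + t • v

/-- The immersed submanifold is minimal: its mean curvature vector vanishes identically. The mean
curvature vector does not depend on the chart in which it is computed. -/
def IsMinimal (f : M → Euc n) : Prop :=
  ∀ e ∈ atlas (Euc m) M, ∀ x ∈ e.target, meanCurvature (f ∘ e.symm) x = 0

/-- The immersed submanifold is full: it is not contained in any affine hyperplane. -/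
def IsFull (f : M → Euc n) : Prop :=
  ¬ ∃ (v : Euc n) (c : ℝ), v ≠ 0 ∧ ∀ p : M, ⟪v, f p⟫ = c

end Immersed

/-- `N` is an embedded minimal submanifold of `ℝⁿ` of dimension `k` which is covered by one chart:
the image of a minimal immersion of an open subset of `ℝᵏ` that is a homeomorphism onto `N`. -/
def IsMinimalPatch {n : ℕ} (k : ℕ) (N : Set (Euc n)) : Prop :=
  ∃ (W : Opens (Euc k)) (g : W → Euc n),
    IsSmoothImmersion k g ∧ IsEmbedding g ∧ IsMinimal k g ∧ range g = N

/-- The immersed submanifold `f : M → ℝⁿ` is (locally) a cylinder over a minimal submanifold of the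
hyperplane `H` through the origin orthogonal to `d`: every point of `M` has an open neighbourhood
`U` embedded by `f` onto `{q + t d : q ∈ N, a < t < b}`, for a minimal submanifold `N ⊆ H`
with `dim N + 1 = dim M`. -/
def IsCylinderOverMinimal (m : ℕ) {n : ℕ} {M : Type*} [TopologicalSpace M] [ChartedSpace (Euc m) M]
    (f : M → Euc n) (d : Euc n) : Prop :=
  ∃ k : ℕ, k + 1 = m ∧ ∀ p : M, ∃ (U : Opens M) (N : Set (Euc n)) (a b : ℝ),
    p ∈ U ∧ IsEmbedding (fun x : U => f x) ∧
      IsMinimalPatch k N ∧ (∀ q ∈ N, ⟪d, q⟫ = 0) ∧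
      f '' (U : Set M) = {x | ∃ q ∈ N, ∃ t ∈ Ioo a b, x = q + t • d}

end MinimalHelix

/-! Let `c = ‖d^⊤‖`, constant by the helix condition. If `c ≠ 0`, then `T = d^⊤ / c` is the
tangential projection of the fixed vector `c⁻¹ d`, so `⟪X, dT(Y)⟫` is the second fundamental form in
the normal direction `ν = c⁻¹ d - T` (`inner_fderiv_tangential`). Straightness of the rulings says
that `T` is constant along its own integral curves.

Carry a tangent frame along the flow of `T`. Then the vectors `vᵢ = dT(Xᵢ)` stay fixed, and the
frame itself moves in `ℝⁿ` along straight lines `aᵢ + t vᵢ`. Minimality in the direction `ν` makes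
the Gram determinant of these lines stationary. Being a polynomial in `t`, it equals its initial
value `1` for all real `t`, even beyond the lifetime of the flow. If the initial frame diagonalizes
the form, with eigenvalues `lᵢ`, this determinant is at least `∏ (1 + t lᵢ)²`, with an excess
measuring the normal parts of the `vᵢ`. Large `t` forces every `lᵢ = 0`, and then the excess forces
`vᵢ = 0` (`eq_zero_of_det_gramLine_eq_one`). Hence `dT = 0` (`fderiv_tangential_eq_zero`) and `d^⊤`
is constant. Now `d - d^⊤` is a fixed normal vector, so `f` lies in a hyperplane orthogonal to it
unless it vanishes; fullness excludes the hyperplane.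

Once `d` is tangent everywhere, a linear projection of `ℝⁿ` gives local coordinates in which `d` is
a coordinate direction, so the submanifold is locally a product (`exists_cylinder_chart`). The
straight factor contributes nothing to the mean curvature, so the base is minimal
(`meanCurvature_eq_zero_of_cylinder`). -/

namespace MinimalHelix

section Calculus

variable {F : Type*} [NormedAddCommGroup F] [NormedSpace ℝ F]

theorem eq_of_hasDerivAt_zero {φ : ℝ → F} {a r s t : ℝ}
    (h : ∀ x ∈ Metric.ball a r, HasDerivAt φ 0 x) (hs : s ∈ Metric.ball a r)
    (ht : t ∈ Metric.ball a r) : φ t = φ s :=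
  Metric.isOpen_ball.is_const_of_deriv_eq_zero (convex_ball a r).isPreconnected
    (fun x hx => (h x hx).differentiableAt.differentiableWithinAt) (fun x hx => (h x hx).deriv) ht hs

end Calculus

/-! ### Gram determinants of families of moving lines. -/

section LinearAlgebra

variable {ι : Type*}

theorem one_add_sum_le_prod_one_add [DecidableEq ι] (s : Finset ι) {μ : ι → ℝ} (h : ∀ i, 0 ≤ μ i) :
    1 + ∑ i ∈ s, μ i ≤ ∏ i ∈ s, (1 + μ i) := by
  induction s using Finset.induction_on with
  | empty => simp
  | insert a s ha ih =>
    rw [Finset.sum_insert ha, Finset.prod_insert ha]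
    nlinarith [h a, Finset.sum_nonneg fun i (_ : i ∈ s) => h i]

variable [Fintype ι] [DecidableEq ι]

/-- In terms of the eigenvalues `μᵢ ≥ 0` of `P` this is `1 + ∑ μᵢ ≤ ∏ (1 + μᵢ)`. -/
theorem one_add_trace_le_det_one_add {P : Matrix ι ι ℝ} (hP : P.PosSemidef) :
    1 + P.trace ≤ (1 + P).det := by
  have hH := hP.isHermitian
  have hdet : (1 + P).det = ∏ i, (1 + hH.eigenvalues i) := by
    have h := hH.spectral_theorem
    set U := hH.eigenvectorUnitary
    have hU : (U : Matrix ι ι ℝ) * star (U : Matrix ι ι ℝ) = 1 := Unitary.mul_star_self_of_mem U.2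
    have h1 : 1 + P = (U : Matrix ι ι ℝ) *
        Matrix.diagonal (fun i => 1 + hH.eigenvalues i) * star (U : Matrix ι ι ℝ) := by
      have h2 : Matrix.diagonal (fun i => 1 + hH.eigenvalues i)
          = 1 + Matrix.diagonal (hH.eigenvalues) := by
        rw [← Matrix.diagonal_one, Matrix.diagonal_add]
      rw [h2, mul_add, add_mul, mul_one, hU]
      conv_lhs => rw [h]
      simp [Unitary.conjStarAlgAut_apply]
    rw [h1, Matrix.det_mul, Matrix.det_mul, mul_right_comm, ← Matrix.det_mul, hU]
    simp
  rw [hdet, hH.trace_eq_sum_eigenvalues]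
  exact one_add_sum_le_prod_one_add _ hP.eigenvalues_nonneg

/-- Jacobi's formula. The derivative depends only on the value and velocity of the curve, so the
curve may be replaced by the affine one `A + s A' = A (1 + s A⁻¹ A')`, whose determinant has linear
coefficient `det A · tr (A⁻¹ A')`. -/
theorem hasDerivAt_det {A : ℝ → Matrix ι ι ℝ} {A' : Matrix ι ι ℝ} {t : ℝ}
    (hA : ∀ i j, HasDerivAt (fun s => A s i j) (A' i j) t) (hu : IsUnit (A t).det) :
    HasDerivAt (fun s => (A s).det) ((A t).det * ((A t)⁻¹ * A').trace) t := by
  let D : (ι → ι → ℝ) → ℝ := fun B => (Matrix.of B).det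
  have hD : Differentiable ℝ D := by
    unfold D
    simp only [Matrix.det_apply', Matrix.of_apply]
    fun_prop
  have hA₁ : HasDerivAt (fun s => (A s : ι → ι → ℝ)) (A' : ι → ι → ℝ) t :=
    hasDerivAt_pi.2 fun i => hasDerivAt_pi.2 fun j => hA i j
  have h1 := (hD (A t : ι → ι → ℝ)).hasFDerivAt.comp_hasDerivAt t hA₁
  have hline : HasDerivAt (fun s : ℝ => fun i j => A t i j + s * A' i j) (A' : ι → ι → ℝ) 0 := by
    refine hasDerivAt_pi.2 fun i => hasDerivAt_pi.2 fun j => ?_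
    simpa using ((hasDerivAt_id (0 : ℝ)).mul_const (A' i j)).const_add (A t i j)
  have h0 : (fun i j => A t i j + (0 : ℝ) * A' i j) = (A t : ι → ι → ℝ) := by
    ext i j; simp
  have h2 := HasFDerivAt.comp_hasDerivAt (l := D) (f := fun s : ℝ => fun i j => A t i j + s * A' i j)
    (0 : ℝ) (by rw [h0]; exact (hD (A t : ι → ι → ℝ)).hasFDerivAt) hline
  have h3 : HasDerivAt (D ∘ fun s : ℝ => fun i j => A t i j + s * A' i j)
      ((A t).det * ((A t)⁻¹ * A').trace) 0 := by
    set p := (1 + (Polynomial.X : Polynomial ℝ) • (((A t)⁻¹ * A').map Polynomial.C)).det with hp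
    have := (p.hasDerivAt 0).const_mul (A t).det
    rw [hp, Matrix.derivative_det_one_add_X_smul] at this
    refine this.congr_of_eventuallyEq (Filter.Eventually.of_forall fun s => ?_)
    beta_reduce
    have h4 : Matrix.of (fun i j => A t i j + s * A' i j) = A t * (1 + s • ((A t)⁻¹ * A')) := by
      rw [mul_add, mul_one, Matrix.mul_smul, ← mul_assoc, Matrix.mul_nonsing_inv _ hu, one_mul]
      ext i j; simp
    change (Matrix.of (fun i j => A t i j + s * A' i j)).det = _
    rw [h4, Matrix.det_mul]
    congr 1
    rw [← Polynomial.coe_evalRingHom, RingHom.map_det]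
    congr 1
    generalize (A t)⁻¹ * A' = Q
    ext i j
    by_cases hij : i = j <;> simp [hij] <;> ring
  rw [h2.unique h3] at h1
  exact h1

variable {F : Type*} [NormedAddCommGroup F] [InnerProductSpace ℝ F]

/-- The Gram matrix of the family `c + t v`. -/
noncomputable def gramLine (c v : ι → F) (t : ℝ) : Matrix ι ι ℝ :=
  Matrix.of fun i j => ⟪c i + t • v i, c j + t • v j⟫

/-- Polynomiality is what extends the constancy of the determinant from small `t` to all `t`. -/
theorem exists_polynomial_det_gramLine (c v : ι → F) :
    ∃ p : Polynomial ℝ, ∀ t, p.eval t = (gramLine c v t).det := by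
  let Q : Matrix ι ι (Polynomial ℝ) := Matrix.of fun i j =>
    Polynomial.C ⟪c i, c j⟫ + Polynomial.C (⟪c i, v j⟫ + ⟪v i, c j⟫) * Polynomial.X
      + Polynomial.C ⟪v i, v j⟫ * Polynomial.X ^ 2
  refine ⟨Q.det, fun t => ?_⟩
  rw [← Polynomial.coe_evalRingHom, RingHom.map_det]
  congr 1
  ext i j
  simp [Q, gramLine, inner_add_left, inner_add_right, inner_smul_left, inner_smul_right]
  ring

/-- Split `vᵢ = lᵢ cᵢ + wᵢ` with `wᵢ` orthogonal to every `cⱼ`. The tangential parts make the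
determinant unbounded as `t → ∞` unless all `lᵢ` vanish, and the parts `wᵢ` can only increase it. -/
theorem eq_zero_of_det_gramLine_eq_one {c v : ι → F} {l : ι → ℝ} (hc : Orthonormal ℝ c)
    (hcv : ∀ i j, ⟪c i, v j⟫ = if i = j then l i else 0)
    (hdet : ∀ t, (gramLine c v t).det = 1) : v = 0 := by
  have hcc : ∀ i j, ⟪c i, c j⟫ = if i = j then (1 : ℝ) else 0 := orthonormal_iff_ite.1 hc
  let w : ι → F := fun i => v i - l i • c i
  have hcw : ∀ i j, ⟪c i, w j⟫ = (0 : ℝ) := by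
    intro i j
    simp only [w, inner_sub_right, inner_smul_right, hcv, hcc]
    split_ifs with h
    · simp [h]
    · simp
  have hwc : ∀ i j, ⟪w i, c j⟫ = (0 : ℝ) := fun i j => by rw [real_inner_comm, hcw]
  have hline : ∀ t i, c i + t • v i = (1 + t * l i) • c i + t • w i := by
    intro t i
    simp only [w]
    module
  -- With `D = diag (1 + t lᵢ)` the Gram matrix is `D (1 + P) D`, where `P` is the Gram matrix of
  -- the vectors `t wᵢ / (1 + t lᵢ)`.
  have key : ∀ t, (∀ i, 1 + t * l i ≠ 0) →
      (∏ i, (1 + t * l i)) ^ 2 * (1 + ∑ i, ‖((1 + t * l i)⁻¹ * t) • w i‖ ^ 2) ≤ 1 := by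
    intro t ht
    let P : Matrix ι ι ℝ := Matrix.of fun i j =>
      ⟪((1 + t * l i)⁻¹ * t) • w i, ((1 + t * l j)⁻¹ * t) • w j⟫
    have hP : P.PosSemidef := Matrix.posSemidef_gram ℝ fun i => ((1 + t * l i)⁻¹ * t) • w i
    have hG : gramLine c v t = Matrix.diagonal (fun i => 1 + t * l i) * (1 + P) *
        Matrix.diagonal (fun i => 1 + t * l i) := by
      ext i j
      rw [Matrix.mul_diagonal, Matrix.diagonal_mul]
      simp only [gramLine, Matrix.of_apply, hline, P, Matrix.add_apply, Matrix.one_apply,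
        inner_add_left, inner_add_right, inner_smul_left, inner_smul_right, hcw, hwc, hcc]
      have hi := ht i
      have hj := ht j
      simp only [conj_trivial]
      split_ifs with h
      · subst h; field_simp; ring
      · field_simp; ring
    have h1 := hdet t
    rw [hG, Matrix.det_mul, Matrix.det_mul, Matrix.det_diagonal] at h1
    have h2 := one_add_trace_le_det_one_add hP
    have h3 : P.trace = ∑ i, ‖((1 + t * l i)⁻¹ * t) • w i‖ ^ 2 := by
      simp only [Matrix.trace, Matrix.diag, P, Matrix.of_apply, real_inner_self_eq_norm_sq]
    rw [← h3]
    nlinarith [sq_nonneg (∏ i, (1 + t * l i))]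
  have hl : ∀ i, l i = 0 := by
    by_contra! hne
    obtain ⟨i₀, hi₀⟩ := hne
    -- From `t ≥ 3 / |lᵢ|` one gets `|t lᵢ| ≥ 3`, hence `|1 + t lᵢ| ≥ 2`; factors with `lᵢ = 0`
    -- equal `1`.
    have hev : ∀ᶠ t : ℝ in Filter.atTop, ∀ i, l i ≠ 0 → 2 ≤ |1 + t * l i| := by
      rw [Filter.eventually_all]
      intro i
      by_cases h : l i = 0
      · simp [h]
      · filter_upwards [Filter.eventually_ge_atTop (3 * |l i|⁻¹)] with t ht _
        have hpos : 0 < |l i| := abs_pos.2 h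
        have ht' : 3 ≤ t * |l i| := by
          have := mul_le_mul_of_nonneg_right ht hpos.le
          rwa [mul_assoc, inv_mul_cancel₀ hpos.ne', mul_one] at this
        have h0 : t * |l i| ≤ |t * l i| := by
          rw [abs_mul]; exact mul_le_mul_of_nonneg_right (le_abs_self t) hpos.le
        have := abs_sub_abs_le_abs_sub (t * l i) (-1)
        rw [abs_neg, abs_one, sub_neg_eq_add, add_comm (t * l i)] at this
        linarith
    obtain ⟨t, ht⟩ := hev.exists
    have hge : ∀ i, 1 ≤ |1 + t * l i| := by
      intro i
      by_cases h : l i = 0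
      · simp [h]
      · linarith [ht i h]
    have hk := key t fun i hi => by have := hge i; rw [hi] at this; norm_num at this
    have hprod : 2 ≤ |∏ i, (1 + t * l i)| := by
      rw [Finset.abs_prod, ← Finset.mul_prod_erase _ _ (Finset.mem_univ i₀)]
      have : (1 : ℝ) ≤ ∏ i ∈ Finset.univ.erase i₀, |1 + t * l i| :=
        Finset.one_le_prod fun i _ => hge i
      nlinarith [ht i₀ hi₀]
    have hs : (0 : ℝ) ≤ ∑ i, ‖((1 + t * l i)⁻¹ * t) • w i‖ ^ 2 :=
      Finset.sum_nonneg fun i _ => sq_nonneg _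
    have h4 : 4 ≤ (∏ i, (1 + t * l i)) ^ 2 := by
      rw [← sq_abs]; nlinarith
    nlinarith
  have hw : ∀ i, w i = 0 := by
    have := key 1 (by simp [hl])
    simp only [hl] at this
    norm_num at this
    have h0 : ∑ i, ‖w i‖ ^ 2 = 0 := le_antisymm (by linarith) (Finset.sum_nonneg fun i _ => sq_nonneg _)
    intro i
    have := (Finset.sum_eq_zero_iff_of_nonneg fun i _ => sq_nonneg ‖w i‖).1 h0 i (Finset.mem_univ i)
    simpa using this
  ext1 i
  have := hw i
  simpa [w, hl] using this

/-- A family of lines whose Gram determinant is stationary, and which is moved within its span by a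
diagonal matrix, does not move. -/
theorem eq_zero_of_trace_gramLine {c v : ι → F} {l : ι → ℝ} (hc : Orthonormal ℝ c)
    (hcv : ∀ i j, ⟪c i, v j⟫ = if i = j then l i else 0)
    (htr : ∀ᶠ t in 𝓝 (0 : ℝ), IsUnit (gramLine c v t).det →
      ((gramLine c v t)⁻¹ * Matrix.of fun i j => ⟪c i + t • v i, v j⟫).trace = 0) : v = 0 := by
  refine eq_zero_of_det_gramLine_eq_one hc hcv ?_
  obtain ⟨p, hp⟩ := exists_polynomial_det_gramLine c v
  have hG0 : gramLine c v 0 = 1 := by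
    ext i j
    simp [gramLine, orthonormal_iff_ite.1 hc, Matrix.one_apply]
  have hp0 : p.eval 0 = 1 := by rw [hp, hG0, Matrix.det_one]
  have hne : ∀ᶠ t in 𝓝 (0 : ℝ), p.eval t ≠ 0 :=
    p.continuous.continuousAt.eventually_ne (by rw [hp0]; exact one_ne_zero)
  obtain ⟨ε, hε, hball⟩ := Metric.eventually_nhds_iff_ball.1 (htr.and hne)
  have hder : ∀ t ∈ Metric.ball (0 : ℝ) ε, HasDerivAt (fun s => p.eval s) 0 t := by
    intro t ht
    obtain ⟨h1, h2⟩ := hball t ht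
    rw [hp] at h2
    have hu : IsUnit (gramLine c v t).det := isUnit_iff_ne_zero.2 h2
    specialize h1 hu
    set B : Matrix ι ι ℝ := Matrix.of fun i j => ⟪c i + t • v i, v j⟫
    -- The product rule gives `G' = B + Bᵀ`. As `G` is symmetric, `B` and `Bᵀ` have the same trace
    -- against `G⁻¹`, namely zero.
    have hd := hasDerivAt_det (A := gramLine c v) (A' := B + B.transpose) (t := t) ?_ hu
    · have hsymm : (gramLine c v t).transpose = gramLine c v t := by
        ext i j; simp [gramLine, real_inner_comm]
      have h3 : ((gramLine c v t)⁻¹ * B.transpose).trace = 0 := by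
        rw [← Matrix.trace_transpose, Matrix.transpose_mul, Matrix.transpose_transpose,
          Matrix.transpose_nonsing_inv, hsymm, Matrix.trace_mul_comm, h1]
      rw [mul_add, Matrix.trace_add, h1, h3, add_zero, mul_zero] at hd
      simpa only [hp] using hd
    · intro i j
      have hl : ∀ k, HasDerivAt (fun s : ℝ => c k + s • v k) (v k) t := fun k => by
        simpa using ((hasDerivAt_id t).smul_const (v k)).const_add (c k)
      have := (hl i).inner ℝ (hl j)
      simpa [B, gramLine, real_inner_comm] using this
  have hconst : ∀ t ∈ Metric.ball (0 : ℝ) ε, p.eval t = 1 := by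
    intro t ht
    rw [← hp0]
    exact eq_of_hasDerivAt_zero hder (Metric.mem_ball_self hε) ht
  have hp1 : p = 1 := by
    refine Polynomial.eq_of_infinite_eval_eq _ _ (Set.Infinite.mono (s := Metric.ball (0 : ℝ) ε) ?_ ?_)
    · intro t ht
      simp [hconst t ht]
    · rw [Real.ball_eq_Ioo]; exact Set.Ioo_infinite (by linarith)
  intro t
  rw [← hp, hp1, Polynomial.eval_one]

end LinearAlgebra

/-! ### The mean curvature vector in arbitrary frames. -/

section MeanCurvature

variable {m n : ℕ}

/-- The Gram matrix of a bilinear form on a family of vectors, in terms of its Gram matrix on the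
standard basis. -/
theorem gram_bilin_eq (B : Euc m →ₗ[ℝ] Euc m →ₗ[ℝ] ℝ) (X : Fin m → Euc m) :
    (Matrix.of fun i j => B (X i) (X j)) =
      (Matrix.of fun k i => X i k).transpose *
        (Matrix.of fun i j => B (EuclideanSpace.single i 1) (EuclideanSpace.single j 1)) *
        Matrix.of fun k i => X i k := by
  have hX : ∀ Y : Euc m, Y = ∑ k, Y k • EuclideanSpace.single k (1 : ℝ) := by
    intro Y
    simpa using ((EuclideanSpace.basisFun (Fin m) ℝ).sum_repr Y).symm
  ext i j
  rw [Matrix.of_apply, hX (X i), hX (X j)]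
  simp only [map_sum, map_smul, LinearMap.sum_apply, LinearMap.smul_apply, smul_eq_mul,
    Matrix.mul_apply, Matrix.transpose_apply, Matrix.of_apply, Finset.sum_mul, Finset.mul_sum]
  refine Finset.sum_congr rfl fun k _ => Finset.sum_congr rfl fun l _ => ?_
  ring

variable {u : Euc m → Euc n} {x : Euc m}

theorem secondForm_eq (hu : DifferentiableAt ℝ (fderiv ℝ u) x) (i j : Fin m) :
    secondForm u x i j = (LinearMap.range (fderiv ℝ u x).toLinearMap)ᗮ.starProjection
      (fderiv ℝ (fderiv ℝ u) x (EuclideanSpace.single i 1) (EuclideanSpace.single j 1)) := by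
  unfold secondForm pd
  congr 1
  rw [fderiv_clm_apply hu (differentiableAt_const _)]
  simp

/-- The normal components of the mean curvature vector, computed in an arbitrary frame. -/
theorem inner_meanCurvature (hu : DifferentiableAt ℝ (fderiv ℝ u) x) {ν : Euc n}
    (hν : ∀ X, ⟪fderiv ℝ u x X, ν⟫ = 0) (X : Fin m → Euc m)
    (hX : IsUnit (Matrix.of fun i j => ⟪fderiv ℝ u x (X i), fderiv ℝ u x (X j)⟫).det) :
    ⟪meanCurvature u x, ν⟫ =
      ((Matrix.of fun i j => ⟪fderiv ℝ u x (X i), fderiv ℝ u x (X j)⟫)⁻¹ *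
        Matrix.of fun i j => ⟪fderiv ℝ (fderiv ℝ u) x (X j) (X i), ν⟫).trace := by
  have hmem : ν ∈ (LinearMap.range (fderiv ℝ u x).toLinearMap)ᗮ := by
    rw [Submodule.mem_orthogonal]
    rintro _ ⟨Y, rfl⟩
    exact hν Y
  let A : Euc m →ₗ[ℝ] Euc m →ₗ[ℝ] ℝ :=
    LinearMap.mk₂ ℝ (fun Y Z => ⟪fderiv ℝ u x Y, fderiv ℝ u x Z⟫)
      (by intros; simp [inner_add_left]) (by intros; simp [inner_smul_left])
      (by intros; simp [inner_add_right]) (by intros; simp [inner_smul_right])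
  let B : Euc m →ₗ[ℝ] Euc m →ₗ[ℝ] ℝ :=
    LinearMap.mk₂ ℝ (fun Y Z => ⟪fderiv ℝ (fderiv ℝ u) x Z Y, ν⟫)
      (by intros; simp [inner_add_left]) (by intros; simp [inner_smul_left])
      (by intros; simp [inner_add_left]) (by intros; simp [inner_smul_left])
  have hA := gram_bilin_eq A X
  have hB := gram_bilin_eq B X
  simp only [A, B, LinearMap.mk₂_apply] at hA hB
  rw [hA, hB]
  rw [hA, Matrix.det_mul, Matrix.det_mul, Matrix.det_transpose] at hX
  set Z : Matrix (Fin m) (Fin m) ℝ := Matrix.of fun k i => X i k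
  have hZ : IsUnit Z.det := isUnit_of_mul_isUnit_right hX
  have hZt : IsUnit Z.transpose.det := by rwa [Matrix.det_transpose]
  rw [Matrix.mul_inv_rev, Matrix.mul_inv_rev]
  have hG : (Matrix.of fun i j => ⟪fderiv ℝ u x (EuclideanSpace.single i 1),
      fderiv ℝ u x (EuclideanSpace.single j 1)⟫) = firstForm u x := rfl
  rw [hG]
  set b : Matrix (Fin m) (Fin m) ℝ := Matrix.of fun i j =>
    ⟪fderiv ℝ (fderiv ℝ u) x (EuclideanSpace.single j 1) (EuclideanSpace.single i 1), ν⟫ with hb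
  -- Both forms transform by `Zᵀ · Z`, so the frame change reduces to a conjugation, which the trace
  -- does not see.
  have hcancel : Z⁻¹ * ((firstForm u x)⁻¹ * Z.transpose⁻¹) * (Z.transpose * b * Z) =
      Z⁻¹ * ((firstForm u x)⁻¹ * b * Z) := by
    simp only [mul_assoc]
    rw [← mul_assoc Z.transpose⁻¹, Matrix.nonsing_inv_mul _ hZt, one_mul]
  rw [hcancel, Matrix.trace_mul_comm, mul_assoc, Matrix.mul_nonsing_inv _ hZ, mul_one]
  simp only [meanCurvature, Matrix.trace, Matrix.diag, Matrix.mul_apply, sum_inner, inner_smul_left,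
    secondForm_eq hu]
  refine Finset.sum_congr rfl fun i _ => Finset.sum_congr rfl fun j _ => ?_
  rw [Submodule.inner_starProjection_left_eq_right, Submodule.starProjection_eq_self_iff.2 hmem]
  simp [hb]

theorem meanCurvature_orthogonal (Y : Euc m) : ⟪fderiv ℝ u x Y, meanCurvature u x⟫ = 0 := by
  have h : meanCurvature u x ∈ (LinearMap.range (fderiv ℝ u x).toLinearMap)ᗮ := by
    refine Submodule.sum_mem _ fun i _ => Submodule.sum_mem _ fun j _ => Submodule.smul_mem _ _ ?_
    exact Submodule.starProjection_apply_mem _ _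
  exact (Submodule.mem_orthogonal _ _).1 h _ ⟨Y, rfl⟩

/-- The normal components of the mean curvature vector, computed in an orthonormal frame. -/
theorem inner_meanCurvature_of_orthonormal (hu : DifferentiableAt ℝ (fderiv ℝ u) x) {ν : Euc n}
    (hν : ∀ X, ⟪fderiv ℝ u x X, ν⟫ = 0) {X : Fin m → Euc m}
    (hX : Orthonormal ℝ fun i => fderiv ℝ u x (X i)) :
    ⟪meanCurvature u x, ν⟫ = ∑ i, ⟪fderiv ℝ (fderiv ℝ u) x (X i) (X i), ν⟫ := by
  have h1 : (Matrix.of fun i j => ⟪fderiv ℝ u x (X i), fderiv ℝ u x (X j)⟫) = 1 := by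
    ext i j
    simp [orthonormal_iff_ite.1 hX, Matrix.one_apply]
  rw [inner_meanCurvature hu hν X (by rw [h1]; simp), h1]
  simp [Matrix.trace]

end MeanCurvature

/-! ### Tangential projections of a fixed vector: the rigidity argument. -/

section TangentialProjection

variable {m n : ℕ}

/-- Simultaneous diagonalization: a frame which is orthonormal for `⟪M ·, M ·⟫` and orthogonal for
the symmetric form `⟪M ·, N ·⟫`. -/
theorem exists_diagonalizing_frame {M N : Euc m →L[ℝ] Euc n} (hM : Function.Injective M)
    (hsymm : ∀ X Y, ⟪M X, N Y⟫ = ⟪M Y, N X⟫) :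
    ∃ (X : Fin m → Euc m) (l : Fin m → ℝ), Orthonormal ℝ (fun i => M (X i)) ∧
      (∀ i j, ⟪M (X i), N (X j)⟫ = if i = j then l i else 0) ∧ ((∀ i, N (X i) = 0) → N = 0) := by
  let R := LinearMap.range M.toLinearMap
  let e : Euc m ≃ₗ[ℝ] R := LinearEquiv.ofInjective M.toLinearMap hM
  have he : ∀ X, (e X : Euc n) = M X := fun X => LinearEquiv.ofInjective_apply M.toLinearMap X
  have he' : ∀ r, M (e.symm r) = r := fun r => by rw [← he, e.apply_symm_apply]
  -- The tangential part of `N ∘ M⁻¹` is a symmetric endomorphism of the range of `M`; the frame is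
  -- the preimage of an orthonormal eigenbasis.
  let S : R →ₗ[ℝ] R := R.orthogonalProjectionOnto.toLinearMap ∘ₗ N.toLinearMap ∘ₗ e.symm.toLinearMap
  have hS_inner : ∀ r r' : R, ⟪r', S r⟫ = ⟪M (e.symm r'), N (e.symm r)⟫ := by
    intro r r'
    rw [he']
    simp only [S, LinearMap.comp_apply]
    exact Submodule.inner_orthogonalProjectionOnto_eq_of_mem_left r' _
  have hS : S.IsSymmetric := by
    intro r r'
    rw [hS_inner, real_inner_comm, hS_inner, hsymm]
  have hfin : Module.finrank ℝ R = m := by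
    rw [← e.finrank_eq, finrank_euclideanSpace_fin]
  let b := hS.eigenvectorBasis hfin
  have hb : ∀ i j, ⟪(b i : Euc n), (b j : Euc n)⟫ = if i = j then (1 : ℝ) else 0 :=
    fun i j => (orthonormal_iff_ite.1 b.orthonormal) i j
  refine ⟨fun i => e.symm (b i), hS.eigenvalues hfin, ?_, ?_, ?_⟩
  · rw [orthonormal_iff_ite]
    intro i j
    rw [he', he', hb]
  · intro i j
    rw [← hS_inner, hS.apply_eigenvectorBasis, inner_smul_right]
    have := (orthonormal_iff_ite.1 b.orthonormal) i j
    simp only [b] at this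
    rw [this]
    split_ifs with h
    · simp [h]
    · simp
  · intro h
    have h0 : N.toLinearMap ∘ₗ e.symm.toLinearMap = 0 := by
      refine b.toBasis.ext fun i => ?_
      simpa using h i
    ext1 X
    simpa using LinearMap.congr_fun h0 (e X)

variable {u : Euc m → Euc n} {τ : Euc m → Euc m} {Ω : Set (Euc m)} {d : Euc n}

/-- The derivative of a vector field along a parametrization which is a tangential projection. -/
theorem inner_fderiv_tangential (hΩ : IsOpen Ω) (hu : ContDiffOn ℝ ∞ u Ω)
    (hτ : ContDiffOn ℝ ∞ τ Ω)
    (hT : ∀ x ∈ Ω, ∀ X, ⟪fderiv ℝ u x X, d - fderiv ℝ u x (τ x)⟫ = 0) {x : Euc m} (hx : x ∈ Ω)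
    (X Y : Euc m) :
    ⟪fderiv ℝ u x X, fderiv ℝ (fun y => fderiv ℝ u y (τ y)) x Y⟫ =
      ⟪fderiv ℝ (fderiv ℝ u) x Y X, d - fderiv ℝ u x (τ x)⟫ := by
  have hu' : ContDiffOn ℝ ∞ (fderiv ℝ u) Ω := hu.fderiv_of_isOpen hΩ (by simp)
  have hTs : ContDiffOn ℝ ∞ (fun y => fderiv ℝ u y (τ y)) Ω := hu'.clm_apply hτ
  have h1 : HasFDerivAt (fderiv ℝ u) (fderiv ℝ (fderiv ℝ u) x) x :=
    ((hu'.contDiffAt (hΩ.mem_nhds hx)).differentiableAt (by simp)).hasFDerivAt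
  have h2 : HasFDerivAt (fun y => fderiv ℝ u y (τ y)) (fderiv ℝ (fun y => fderiv ℝ u y (τ y)) x) x :=
    ((hTs.contDiffAt (hΩ.mem_nhds hx)).differentiableAt (by simp)).hasFDerivAt
  have h3 := (h1.clm_apply (hasFDerivAt_const X x)).inner ℝ ((hasFDerivAt_const d x).sub h2)
  have h4 : HasFDerivAt (fun y => ⟪fderiv ℝ u y X, d - fderiv ℝ u y (τ y)⟫)
      (0 : Euc m →L[ℝ] ℝ) x :=
    (hasFDerivAt_const (0 : ℝ) x).congr_of_eventuallyEq
      (by filter_upwards [hΩ.mem_nhds hx] with y hy using hT y hy X)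
  have h5 := congrArg (fun L : Euc m →L[ℝ] ℝ => L Y) (h3.unique h4)
  simp [fderivInnerCLM_apply, inner_sub_right] at h5
  rw [inner_sub_right]
  linarith

/-- If the tangential part `T` of a fixed vector along a minimal parametrization is parallel (in the
ambient space) along its own integral curves, then it is locally constant. -/
theorem fderiv_tangential_eq_zero (hΩ : IsOpen Ω) (hu : ContDiffOn ℝ ∞ u Ω)
    (hinj : ∀ x ∈ Ω, Function.Injective (fderiv ℝ u x)) (hτ : ContDiffOn ℝ ∞ τ Ω)
    (hT : ∀ x ∈ Ω, ∀ X, ⟪fderiv ℝ u x X, d - fderiv ℝ u x (τ x)⟫ = 0)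
    (hgeo : ∀ x ∈ Ω, fderiv ℝ (fun y => fderiv ℝ u y (τ y)) x (τ x) = 0)
    (hmin : ∀ x ∈ Ω, meanCurvature u x = 0) {x₀ : Euc m} (hx₀ : x₀ ∈ Ω) :
    fderiv ℝ (fun y => fderiv ℝ u y (τ y)) x₀ = 0 := by
  set T : Euc m → Euc n := fun y => fderiv ℝ u y (τ y) with hTdef
  have hu' : ContDiffOn ℝ ∞ (fderiv ℝ u) Ω := hu.fderiv_of_isOpen hΩ (by simp)
  have hTs : ContDiffOn ℝ ∞ T Ω := hu'.clm_apply hτ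
  have hT' : ContDiffOn ℝ ∞ (fderiv ℝ T) Ω := hTs.fderiv_of_isOpen hΩ (by simp)
  have hτ' : ContDiffOn ℝ ∞ (fderiv ℝ τ) Ω := hτ.fderiv_of_isOpen hΩ (by simp)
  have diff : ∀ {G : Type} [NormedAddCommGroup G] [NormedSpace ℝ G] {h : Euc m → G},
      ContDiffOn ℝ ∞ h Ω → ∀ x ∈ Ω, HasFDerivAt h (fderiv ℝ h x) x := fun hh x hx =>
    ((hh.contDiffAt (hΩ.mem_nhds hx)).differentiableAt (by simp)).hasFDerivAt
  have symm : ∀ {h : Euc m → Euc n}, ContDiffOn ℝ ∞ h Ω → ∀ x ∈ Ω, ∀ X Y,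
      fderiv ℝ (fderiv ℝ h) x X Y = fderiv ℝ (fderiv ℝ h) x Y X := fun hh x hx X Y =>
    (hh.contDiffAt (hΩ.mem_nhds hx)).isSymmSndFDerivAt (by simp; exact WithTop.coe_le_coe.2 (le_top : (2 : ℕ∞) ≤ ⊤)) X Y
  have hA : ∀ x ∈ Ω, ∀ X Y, ⟪fderiv ℝ u x X, fderiv ℝ T x Y⟫ =
      ⟪fderiv ℝ (fderiv ℝ u) x Y X, d - T x⟫ := fun x hx X Y =>
    inner_fderiv_tangential hΩ hu hτ hT hx X Y
  have hdT : ∀ x ∈ Ω, ∀ X,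
      fderiv ℝ T x X = fderiv ℝ (fderiv ℝ u) x (τ x) X + fderiv ℝ u x (fderiv ℝ τ x X) := by
    intro x hx X
    rw [((diff hu' x hx).clm_apply (diff hτ x hx)).fderiv]
    simp [symm hu x hx X, add_comm]
  -- Differentiating `dT(τ) = 0` in the direction `X` gives exactly the derivative of `dT(X)` along
  -- the linearized flow.
  have hddT : ∀ x ∈ Ω, ∀ X,
      fderiv ℝ (fderiv ℝ T) x (τ x) X + fderiv ℝ T x (fderiv ℝ τ x X) = 0 := by
    intro x hx X
    have h1 := (diff hT' x hx).clm_apply (diff hτ x hx)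
    have h2 : HasFDerivAt (fun y => fderiv ℝ T y (τ y)) (0 : Euc m →L[ℝ] Euc n) x :=
      (hasFDerivAt_const (0 : Euc n) x).congr_of_eventuallyEq
        (by filter_upwards [hΩ.mem_nhds hx] with y hy using hgeo y hy)
    have h3 := congrArg (fun L : Euc m →L[ℝ] Euc n => L X) (h1.unique h2)
    simp [symm hTs x hx X] at h3
    rw [add_comm]
    exact h3
  obtain ⟨X₀, l, hX₀, hl, hN⟩ := exists_diagonalizing_frame (N := fderiv ℝ T x₀) (hinj x₀ hx₀)
    (fun X Y => by rw [hA x₀ hx₀, hA x₀ hx₀, symm hu x₀ hx₀])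
  refine hN fun i => ?_
  suffices h : (fun i => fderiv ℝ T x₀ (X₀ i)) = 0 from congrFun h i
  -- the linearized flow of `τ`, starting at the frame `X₀`
  let V : Euc m × (Fin m → Euc m) → Euc m × (Fin m → Euc m) := fun z =>
    (τ z.1, fun i => fderiv ℝ τ z.1 (z.2 i))
  have hV : ContDiffAt ℝ 1 V (x₀, X₀) := by
    have h1 : ContDiffAt ℝ 1 (fun z : Euc m × (Fin m → Euc m) => τ z.1) (x₀, X₀) :=
      ContDiffAt.comp (x₀, X₀) (((hτ.contDiffAt (hΩ.mem_nhds hx₀))).of_le (by simp)) contDiffAt_fst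
    have h2 : ContDiffAt ℝ 1 (fun z : Euc m × (Fin m → Euc m) => fderiv ℝ τ z.1) (x₀, X₀) :=
      ContDiffAt.comp (x₀, X₀) (((hτ'.contDiffAt (hΩ.mem_nhds hx₀))).of_le (by simp)) contDiffAt_fst
    refine h1.prodMk (contDiffAt_pi.2 fun i => h2.clm_apply ?_)
    exact ((contDiff_apply ℝ (Euc m) i).comp contDiff_snd).contDiffAt
  obtain ⟨α, hα0, ε, hε, hα⟩ :=
    hV.exists_forall_mem_closedBall_exists_eq_forall_mem_Ioo_hasDerivAt₀ 0
  have hγ0 : (α 0).1 = x₀ := by rw [hα0]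
  have hα0' : HasDerivAt α (V (α 0)) 0 := hα 0 (by constructor <;> linarith)
  have hev : ∀ᶠ t in 𝓝 (0 : ℝ), t ∈ Ioo (0 - ε) (0 + ε) ∧ (α t).1 ∈ Ω := by
    refine Filter.Eventually.and (Ioo_mem_nhds (by linarith) (by linarith)) ?_
    refine (continuous_fst.continuousAt.comp hα0'.continuousAt).eventually_mem ?_
    exact hΩ.mem_nhds (by simpa [hγ0] using hx₀)
  obtain ⟨δ, hδ, hball⟩ := Metric.eventually_nhds_iff_ball.1 hev
  have hγ : ∀ t ∈ Metric.ball (0 : ℝ) δ, HasDerivAt (fun s => (α s).1) (τ (α t).1) t :=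
    fun t ht => (hα t (hball t ht).1).fst
  have hX : ∀ t ∈ Metric.ball (0 : ℝ) δ, ∀ i,
      HasDerivAt (fun s => (α s).2 i) (fderiv ℝ τ (α t).1 ((α t).2 i)) t :=
    fun t ht i => hasDerivAt_pi.1 (hα t (hball t ht).1).snd i
  have h0 : (0 : ℝ) ∈ Metric.ball (0 : ℝ) δ := Metric.mem_ball_self hδ
  have hv : ∀ t ∈ Metric.ball (0 : ℝ) δ, ∀ i,
      fderiv ℝ T (α t).1 ((α t).2 i) = fderiv ℝ T x₀ (X₀ i) := by
    intro t ht i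
    have := eq_of_hasDerivAt_zero (φ := fun t => fderiv ℝ T (α t).1 ((α t).2 i)) (fun s hs => ?_) h0 ht
    · simpa only [hα0] using this
    · have hs' := (hball s hs).2
      have h1 : HasDerivAt (fun t => fderiv ℝ T (α t).1)
          (fderiv ℝ (fderiv ℝ T) (α s).1 (τ (α s).1)) s :=
        (diff hT' _ hs').comp_hasDerivAt s (hγ s hs)
      have h2 := h1.clm_apply (hX s hs i)
      rwa [hddT _ hs'] at h2
  have ha : ∀ t ∈ Metric.ball (0 : ℝ) δ, ∀ i,
      fderiv ℝ u (α t).1 ((α t).2 i) = fderiv ℝ u x₀ (X₀ i) + t • fderiv ℝ T x₀ (X₀ i) := by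
    intro t ht i
    have := eq_of_hasDerivAt_zero
      (φ := fun t => fderiv ℝ u (α t).1 ((α t).2 i) - t • fderiv ℝ T x₀ (X₀ i)) (fun s hs => ?_) h0 ht
    · simp only [hα0, zero_smul, sub_zero] at this
      rw [← this, sub_add_cancel]
    · have hs' := (hball s hs).2
      have h1 : HasDerivAt (fun t => fderiv ℝ u (α t).1)
          (fderiv ℝ (fderiv ℝ u) (α s).1 (τ (α s).1)) s :=
        (diff hu' _ hs').comp_hasDerivAt s (hγ s hs)
      have h2 := (h1.clm_apply (hX s hs i)).sub
        ((hasDerivAt_id s).smul_const (fderiv ℝ T x₀ (X₀ i)))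
      rw [← hdT _ hs', hv s hs i, one_smul, sub_self] at h2
      exact h2
  refine eq_zero_of_trace_gramLine hX₀ hl ?_
  filter_upwards [Metric.ball_mem_nhds 0 hδ] with t ht hunit
  have ht' := (hball t ht).2
  have hG : gramLine (fun i => fderiv ℝ u x₀ (X₀ i)) (fun i => fderiv ℝ T x₀ (X₀ i)) t =
      Matrix.of fun i j => ⟪fderiv ℝ u (α t).1 ((α t).2 i), fderiv ℝ u (α t).1 ((α t).2 j)⟫ := by
    ext i j
    simp only [gramLine, Matrix.of_apply, ha t ht]
  -- By `hA` at the moved point, these entries are the second fundamental form in the normal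
  -- direction `d - T`, so the trace is `⟪meanCurvature, d - T⟫`.
  have hB : (Matrix.of fun i j => ⟪fderiv ℝ u x₀ (X₀ i) + t • fderiv ℝ T x₀ (X₀ i),
      fderiv ℝ T x₀ (X₀ j)⟫) = Matrix.of fun i j =>
        ⟪fderiv ℝ (fderiv ℝ u) (α t).1 ((α t).2 j) ((α t).2 i), d - T (α t).1⟫ := by
    ext i j
    simp only [Matrix.of_apply]
    rw [← hA _ ht', ha t ht, hv t ht]
  rw [hG] at hunit ⊢
  rw [hB, ← inner_meanCurvature (diff hu' _ ht').differentiableAt (hT _ ht') _ hunit,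
    hmin _ ht', inner_zero_left]

end TangentialProjection

/-! ### Smoothness of the tangential part. -/

section TangentialField

variable {m n : ℕ}

theorem _root_.ContDiffOn.adjoint_apply {A : Euc m → Euc m →L[ℝ] Euc n} {z : Euc m → Euc n}
    {Ω : Set (Euc m)} {k : ℕ∞ω} (hA : ContDiffOn ℝ k A Ω) (hz : ContDiffOn ℝ k z Ω) :
    ContDiffOn ℝ k (fun x => ContinuousLinearMap.adjoint (A x) (z x)) Ω := by
  rw [contDiffOn_euclidean]
  intro i
  have h : ∀ x, ContinuousLinearMap.adjoint (A x) (z x) i =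
      ⟪A x (EuclideanSpace.single i 1), z x⟫ := by
    intro x
    rw [← ContinuousLinearMap.adjoint_inner_right, EuclideanSpace.inner_single_left]
    simp
  simp only [h]
  exact (hA.clm_apply contDiffOn_const).inner ℝ hz

/-- The tangential part of a fixed vector along an immersed parametrization is given by a smooth
vector field. -/
theorem exists_tangential_field {u : Euc m → Euc n} {Ω : Set (Euc m)} (hΩ : IsOpen Ω)
    (hu : ContDiffOn ℝ ∞ u Ω) (hinj : ∀ x ∈ Ω, Function.Injective (fderiv ℝ u x)) (d : Euc n) :
    ∃ τ : Euc m → Euc m, ContDiffOn ℝ ∞ τ Ω ∧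
      ∀ x ∈ Ω, ∀ X, ⟪fderiv ℝ u x X, d - fderiv ℝ u x (τ x)⟫ = 0 := by
  have hu' : ContDiffOn ℝ ∞ (fderiv ℝ u) Ω := hu.fderiv_of_isOpen hΩ (by simp)
  -- With `A = du(x)` the normal equations give `τ = (A* A)⁻¹ A* d`; injectivity of `A` makes `A* A`
  -- invertible, and inversion is smooth.
  let Q : Euc m → Euc m →L[ℝ] Euc m := fun x =>
    (ContinuousLinearMap.adjoint (fderiv ℝ u x)).comp (fderiv ℝ u x)
  have hQ : ContDiffOn ℝ ∞ Q Ω :=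
    contDiffOn_clm_apply.2 fun Y => hu'.adjoint_apply (hu'.clm_apply contDiffOn_const)
  have hQinv : ∀ x ∈ Ω, ∃ e : Euc m ≃L[ℝ] Euc m, (e : Euc m →L[ℝ] Euc m) = Q x := by
    intro x hx
    have hQinj : Function.Injective (Q x).toLinearMap := by
      rw [← LinearMap.ker_eq_bot, LinearMap.ker_eq_bot']
      intro Y hY
      have h1 : ⟪fderiv ℝ u x Y, fderiv ℝ u x Y⟫ = 0 := by
        rw [← ContinuousLinearMap.adjoint_inner_right]
        have : ContinuousLinearMap.adjoint (fderiv ℝ u x) (fderiv ℝ u x Y) = 0 := hY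
        rw [this, inner_zero_right]
      exact hinj x hx (by rw [inner_self_eq_zero.1 h1, map_zero])
    refine ⟨(LinearEquiv.ofInjectiveEndo _ hQinj).toContinuousLinearEquiv, ?_⟩
    ext1 Y
    rfl
  refine ⟨fun x => (Q x).inverse (ContinuousLinearMap.adjoint (fderiv ℝ u x) d), ?_, ?_⟩
  · intro x hx
    obtain ⟨e, he⟩ := hQinv x hx
    have h1 : ContDiffWithinAt ℝ ∞ (fun x => (Q x).inverse) Ω x := by
      have := contDiffAt_map_inverse (n := ∞) e
      rw [he] at this
      exact this.comp_contDiffWithinAt x (hQ x hx)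
    exact h1.clm_apply (hu'.adjoint_apply contDiffOn_const x hx)
  · intro x hx X
    obtain ⟨e, he⟩ := hQinv x hx
    rw [← ContinuousLinearMap.adjoint_inner_right, map_sub]
    have h2 : Q x ((Q x).inverse (ContinuousLinearMap.adjoint (fderiv ℝ u x) d)) =
        ContinuousLinearMap.adjoint (fderiv ℝ u x) d := by
      rw [← he, ContinuousLinearMap.inverse_equiv]
      exact e.apply_symm_apply _
    have h3 : ContinuousLinearMap.adjoint (fderiv ℝ u x)
        (fderiv ℝ u x ((Q x).inverse (ContinuousLinearMap.adjoint (fderiv ℝ u x) d))) =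
        ContinuousLinearMap.adjoint (fderiv ℝ u x) d := h2
    rw [h3, sub_self, inner_zero_right]

end TangentialField

/-! ### Passage between the manifold and its charts. -/

section Charts

variable {m n : ℕ} {M : Type*} [TopologicalSpace M] [ChartedSpace (Euc m) M]

theorem eq_of_hasFDerivAt_chart_zero [ConnectedSpace M] {F : Type*} [NormedAddCommGroup F]
    [NormedSpace ℝ F] {h : M → F}
    (hh : ∀ p : M, ∀ x ∈ (chartAt (Euc m) p).target,
      HasFDerivAt (h ∘ (chartAt (Euc m) p).symm) (0 : Euc m →L[ℝ] F) x) (p q : M) : h p = h q := by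
  refine IsLocallyConstant.apply_eq_of_preconnectedSpace ?_ p q
  rw [IsLocallyConstant.iff_eventually_eq]
  intro p
  set e := chartAt (Euc m) p
  obtain ⟨r, hr, hball⟩ := Metric.isOpen_iff.1 e.open_target _ (mem_chart_target (Euc m) p)
  filter_upwards [e.continuousAt (mem_chart_source _ p) (Metric.ball_mem_nhds _ hr),
    e.open_source.mem_nhds (mem_chart_source _ p)] with q hq hqs
  have := Metric.isOpen_ball.is_const_of_fderiv_eq_zero (𝕜 := ℝ) (f := h ∘ e.symm)
    (convex_ball (e p) r).isPreconnected
    (fun x hx => (hh p x (hball hx)).differentiableAt.differentiableWithinAt)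
    (fun x hx => (hh p x (hball hx)).fderiv) hq (Metric.mem_ball_self hr)
  simpa [e.left_inv hqs, e.left_inv (mem_chart_source _ p)] using this

variable {f : M → Euc n}

theorem IsSmoothImmersion.contDiffOn_chart [IsManifold (𝓡 m) ∞ M]
    (hf : IsSmoothImmersion m f) (p : M) :
    ContDiffOn ℝ ∞ (f ∘ (chartAt (Euc m) p).symm) (chartAt (Euc m) p).target := by
  rw [← contMDiffOn_iff_contDiffOn]
  exact hf.1.comp_contMDiffOn contMDiffOn_chart_symm

theorem IsSmoothImmersion.exists_fderiv_chart [IsManifold (𝓡 m) ∞ M]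
    (hf : IsSmoothImmersion m f) (p : M) {x : Euc m}
    (hx : x ∈ (chartAt (Euc m) p).target) :
    ∃ L : Euc m →L[ℝ] TangentSpace (𝓡 m) ((chartAt (Euc m) p).symm x),
      HasMFDerivAt (𝓡 m) (𝓡 m) (chartAt (Euc m) p).symm x L ∧ Function.Bijective L ∧
      ∀ X, fderiv ℝ (f ∘ (chartAt (Euc m) p).symm) x X =
        differential m f ((chartAt (Euc m) p).symm x) (L X) := by
  set e := chartAt (Euc m) p
  have : IsManifold (𝓡 m) 1 M := IsManifold.of_le (n := ∞) (by simp)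
  have he := mdifferentiable_chart (I := 𝓡 m) p
  refine ⟨mfderiv (𝓡 m) (𝓡 m) e.symm x, (he.mdifferentiableAt_symm hx).hasMFDerivAt,
    he.symm.mfderiv_bijective hx, fun X => ?_⟩
  have h1 : HasMFDerivAt (𝓡 m) 𝓘(ℝ, Euc n) f (e.symm x) (differential m f (e.symm x)) :=
    ((hf.1 _).mdifferentiableAt (by simp)).hasMFDerivAt
  let D : Euc m →L[ℝ] Euc n := (differential m f (e.symm x)).comp (mfderiv (𝓡 m) (𝓡 m) e.symm x)
  have h2 : HasFDerivAt (f ∘ e.symm) D x :=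
    (h1.comp x (he.mdifferentiableAt_symm hx).hasMFDerivAt).hasFDerivAt
  rw [h2.fderiv]
  rfl

theorem IsSmoothImmersion.injective_fderiv_chart [IsManifold (𝓡 m) ∞ M]
    (hf : IsSmoothImmersion m f) (p : M) {x : Euc m}
    (hx : x ∈ (chartAt (Euc m) p).target) :
    Function.Injective (fderiv ℝ (f ∘ (chartAt (Euc m) p).symm) x) := by
  obtain ⟨L, -, hL, h⟩ := hf.exists_fderiv_chart p hx
  intro X Y hXY
  rw [h, h] at hXY
  exact hL.1 (hf.2 _ hXY)

theorem IsSmoothImmersion.range_fderiv_chart [IsManifold (𝓡 m) ∞ M]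
    (hf : IsSmoothImmersion m f) (p : M) {x : Euc m}
    (hx : x ∈ (chartAt (Euc m) p).target) :
    LinearMap.range (fderiv ℝ (f ∘ (chartAt (Euc m) p).symm) x).toLinearMap =
      tangentPlane m f ((chartAt (Euc m) p).symm x) := by
  obtain ⟨L, -, hL, h⟩ := hf.exists_fderiv_chart p hx
  ext y
  constructor
  · rintro ⟨X, rfl⟩
    exact ⟨L X, (h X).symm⟩
  · rintro ⟨Y, rfl⟩
    obtain ⟨X, rfl⟩ := hL.2 Y
    exact ⟨X, h X⟩

/-- This turns constancy of the angle into constancy of `‖d^⊤‖`. The convention `π/2` for a zero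
vector keeps it valid when `d^⊤ = 0`. -/
theorem norm_tangentPart (f : M → Euc n) (d : Euc n) (p : M) :
    ‖tangentPart m f d p‖ = ‖d‖ * Real.cos (helixAngle m f d p) := by
  have h1 : ⟪d, tangentPart m f d p⟫ = ‖tangentPart m f d p‖ ^ 2 := by
    rw [← real_inner_self_eq_norm_sq]
    unfold tangentPart
    rw [Submodule.inner_starProjection_left_eq_right,
      Submodule.starProjection_eq_self_iff.2 (Submodule.starProjection_apply_mem _ _)]
  unfold helixAngle
  by_cases h0 : tangentPart m f d p = 0
  · simp [h0]
  · have h2 := InnerProductGeometry.cos_angle_mul_norm_mul_norm d (tangentPart m f d p)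
    have h3 := norm_ne_zero_iff.2 h0
    apply mul_right_cancel₀ h3
    linarith

theorem differential_unitField (hf : IsSmoothImmersion m f) (d : Euc n) (p : M) :
    differential m f p (unitField m f d p) = ‖tangentPart m f d p‖⁻¹ • tangentPart m f d p := by
  have hmem : ‖tangentPart m f d p‖⁻¹ • tangentPart m f d p ∈ tangentPlane m f p :=
    Submodule.smul_mem _ _ (Submodule.starProjection_apply_mem _ _)
  obtain ⟨Y, hY⟩ := hmem
  unfold unitField
  rw [← hY, LinearMap.leftInverse_apply_of_inj (LinearMap.ker_eq_bot.2 (hf.2 p))]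
  rfl

end Charts

/-! ### Constancy of the tangential part and tangency of the axis. -/

section Rigidity

variable {m n : ℕ} {M : Type*} [TopologicalSpace M] [ChartedSpace (Euc m) M]
  [IsManifold (𝓡 m) ∞ M] {f : M → Euc n} {d : Euc n}

/-- Along a ruled helix the unit tangential part of `d` is constant along its integral curves. -/
theorem IsRuled.fderiv_tangential_self (hruled : IsRuled m f d) (hf : IsSmoothImmersion m f) (p : M)
    {τ : Euc m → Euc m} (hτ : ContDiffOn ℝ ∞ τ (chartAt (Euc m) p).target)
    (hτd : ∀ x ∈ (chartAt (Euc m) p).target, fderiv ℝ (f ∘ (chartAt (Euc m) p).symm) x (τ x) =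
      ‖tangentPart m f d ((chartAt (Euc m) p).symm x)‖⁻¹ •
        tangentPart m f d ((chartAt (Euc m) p).symm x))
    {x : Euc m} (hx : x ∈ (chartAt (Euc m) p).target) :
    fderiv ℝ (fun y => fderiv ℝ (f ∘ (chartAt (Euc m) p).symm) y (τ y)) x (τ x) = 0 := by
  set e := chartAt (Euc m) p
  set u := f ∘ e.symm
  have hu : ContDiffOn ℝ ∞ u e.target := hf.contDiffOn_chart p
  have hT : ContDiffOn ℝ ∞ (fun y => fderiv ℝ u y (τ y)) e.target :=
    (hu.fderiv_of_isOpen e.open_target (by simp)).clm_apply hτ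
  have hnhds := e.open_target.mem_nhds hx
  obtain ⟨γ, hγ0, ε, hε, hγ⟩ :=
    ContDiffAt.exists_forall_mem_closedBall_exists_eq_forall_mem_Ioo_hasDerivAt₀
      ((hτ.contDiffAt hnhds).of_le (by simp)) 0
  have hγ0' : HasDerivAt γ (τ x) 0 := by
    have := hγ 0 (by constructor <;> linarith)
    rwa [hγ0] at this
  have hev : ∀ᶠ t in 𝓝 (0 : ℝ), t ∈ Ioo (0 - ε) (0 + ε) ∧ γ t ∈ e.target :=
    Filter.Eventually.and (Ioo_mem_nhds (by linarith) (by linarith))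
      (hγ0'.continuousAt.eventually_mem (by rwa [hγ0]))
  obtain ⟨δ, hδ, hball⟩ := Metric.eventually_nhds_iff_ball.1 hev
  have hIoo : Ioo (-δ) δ ⊆ Metric.ball (0 : ℝ) δ := by simp [Real.ball_eq_Ioo]
  have hcurve : IsMIntegralCurveOn (e.symm ∘ γ) (unitField m f d) (Ioo (-δ) δ) := by
    intro t ht
    obtain ⟨ht1, ht2⟩ := hball t (hIoo ht)
    obtain ⟨L, hL, -, hLf⟩ := hf.exists_fderiv_chart p ht2
    have h1 := (hL.comp t (hγ t ht1).hasFDerivAt.hasMFDerivAt).hasMFDerivWithinAt (s := Ioo (-δ) δ)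
    have h2 : L (τ (γ t)) = unitField m f d (e.symm (γ t)) := by
      apply hf.2
      rw [← hLf, differential_unitField hf]
      exact hτd _ ht2
    refine h1.congr_mfderiv ?_
    rw [Function.comp_apply, ← h2]
    ext1
    change L ((1 : ℝ) • τ (γ t)) = (1 : ℝ) • L (τ (γ t))
    rw [one_smul, one_smul]
  obtain ⟨c, v, hcv⟩ := hruled _ _ _ hcurve
  -- The field along the curve is the velocity of its image, an affinely parametrized line.
  have hTv : ∀ t ∈ Ioo (-δ) δ, fderiv ℝ u (γ t) (τ (γ t)) = v := by
    intro t ht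
    obtain ⟨ht1, ht2⟩ := hball t (hIoo ht)
    have h1 : HasDerivAt (fun s => u (γ s)) (fderiv ℝ u (γ t) (τ (γ t))) t :=
      ((hu.contDiffAt (e.open_target.mem_nhds ht2)).differentiableAt
        (by simp)).hasFDerivAt.comp_hasDerivAt t (hγ t ht1)
    have h2 : HasDerivAt (fun s : ℝ => c + s • v) v t := by
      simpa using ((hasDerivAt_id t).smul_const v).const_add c
    exact h1.unique (h2.congr_of_eventuallyEq
      (by filter_upwards [isOpen_Ioo.mem_nhds ht] with s hs using hcv s hs))
  have h3 : HasDerivAt (fun t => fderiv ℝ u (γ t) (τ (γ t)))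
      (fderiv ℝ (fun y => fderiv ℝ u y (τ y)) x (τ x)) 0 := by
    have h4 := ((hT.contDiffAt hnhds).differentiableAt (by simp)).hasFDerivAt
    rw [← hγ0] at h4 hγ0'
    have := h4.comp_hasDerivAt (0 : ℝ) hγ0'
    rwa [hγ0] at this
  refine h3.unique ((hasDerivAt_const (0 : ℝ) v).congr_of_eventuallyEq ?_)
  filter_upwards [Ioo_mem_nhds (neg_lt_zero.2 hδ) hδ] with t ht using hTv t ht

/-- The tangential part of the axis of a minimal ruled helix is constant. -/
theorem tangentPart_eq [ConnectedSpace M] (hf : IsSmoothImmersion m f) (hhelix : IsHelix m f d)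
    (hruled : IsRuled m f d) (hmin : IsMinimal m f) (p q : M) :
    tangentPart m f d p = tangentPart m f d q := by
  obtain ⟨θ, hθ⟩ := hhelix
  have hnorm : ∀ p : M, ‖tangentPart m f d p‖ = ‖d‖ * Real.cos θ := fun p => by
    rw [norm_tangentPart, hθ]
  generalize ‖d‖ * Real.cos θ = c at hnorm
  by_cases hc : c = 0
  · rw [norm_eq_zero.1 ((hnorm p).trans hc), norm_eq_zero.1 ((hnorm q).trans hc)]
  refine eq_of_hasFDerivAt_chart_zero (m := m) (fun p x hx => ?_) p q
  set e := chartAt (Euc m) p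
  -- Since `‖d^⊤‖ = c` everywhere, the normalized field is itself the projection of one fixed
  -- vector, `c⁻¹ d`.
  obtain ⟨τ, hτ, hτd⟩ := exists_tangential_field e.open_target (hf.contDiffOn_chart p)
    (fun x hx => hf.injective_fderiv_chart p hx) (c⁻¹ • d)
  have hproj : ∀ y ∈ e.target, fderiv ℝ (f ∘ e.symm) y (τ y) =
      c⁻¹ • tangentPart m f d (e.symm y) := by
    intro y hy
    unfold tangentPart
    rw [← map_smul]
    refine (Submodule.eq_starProjection_of_mem_of_inner_eq_zero ?_ ?_).symm <;>
      rw [← hf.range_fderiv_chart p hy]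
    · exact ⟨τ y, rfl⟩
    rintro _ ⟨X, rfl⟩
    rw [real_inner_comm]
    exact hτd y hy X
  have h0 := fderiv_tangential_eq_zero e.open_target (hf.contDiffOn_chart p)
    (fun x hx => hf.injective_fderiv_chart p hx) hτ hτd
    (fun y hy => hruled.fderiv_tangential_self hf p hτ
      (fun z hz => by rw [hproj z hz, hnorm]) hy)
    (hmin e (chart_mem_atlas _ p)) hx
  have hT : ContDiffOn ℝ ∞ (fun y => fderiv ℝ (f ∘ e.symm) y (τ y)) e.target :=
    ((hf.contDiffOn_chart p).fderiv_of_isOpen e.open_target (by simp)).clm_apply hτ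
  have hnhds := e.open_target.mem_nhds hx
  have h1 := (((hT.contDiffAt hnhds).differentiableAt (by simp)).hasFDerivAt).const_smul c
  rw [h0, smul_zero] at h1
  refine h1.congr_of_eventuallyEq ?_
  filter_upwards [hnhds] with y hy
  simp only [Pi.smul_apply, hproj y hy, Function.comp, smul_smul, mul_inv_cancel₀ hc, one_smul]

/-- The axis of a full minimal ruled helix is tangent to it. -/
theorem mem_tangentPlane [ConnectedSpace M] (hf : IsSmoothImmersion m f) (hhelix : IsHelix m f d)
    (hruled : IsRuled m f d) (hmin : IsMinimal m f) (hfull : IsFull f) (p : M) :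
    d ∈ tangentPlane m f p := by
  have hconst := tangentPart_eq hf hhelix hruled hmin
  by_contra hd
  refine hfull ⟨d - tangentPart m f d p, ⟪d - tangentPart m f d p, f p⟫, ?_, fun q => ?_⟩
  · intro h
    exact hd (Submodule.starProjection_eq_self_iff.1 (sub_eq_zero.1 h).symm)
  · refine eq_of_hasFDerivAt_chart_zero (m := m) (h := fun q => ⟪d - tangentPart m f d p, f q⟫)
      (fun q x hx => ?_) q p
    set e := chartAt (Euc m) q
    have h1 := (((hf.contDiffOn_chart q).contDiffAt
      (e.open_target.mem_nhds hx)).differentiableAt (by simp)).hasFDerivAt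
    have h2 := (innerSL ℝ (d - tangentPart m f d p)).hasFDerivAt.comp x h1
    have h3 : (innerSL ℝ (d - tangentPart m f d p)).comp (fderiv ℝ (f ∘ e.symm) x) = 0 := by
      ext1 X
      have hX : fderiv ℝ (f ∘ e.symm) x X ∈ tangentPlane m f (e.symm x) := by
        rw [← hf.range_fderiv_chart q hx]
        exact ⟨X, rfl⟩
      rw [hconst p (e.symm x)]
      exact Submodule.starProjection_inner_eq_zero d _ hX
    rw [h3] at h2
    exact h2

end Rigidity

/-! ### Minimality of the base of a minimal cylinder. -/

section CylinderMeanCurvature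

variable {k n : ℕ}

theorem meanCurvature_congr {m : ℕ} {u v : Euc m → Euc n} {x : Euc m} (h : u =ᶠ[𝓝 x] v) :
    meanCurvature u x = meanCurvature v x := by
  have hpd : ∀ i, (fun y => pd u y i) =ᶠ[𝓝 x] fun y => pd v y i := fun i => by
    filter_upwards [h.fderiv (𝕜 := ℝ)] with y hy
    simp only [pd, hy]
  have h1 : firstForm u x = firstForm v x := by
    ext i j
    simp only [firstForm, Matrix.of_apply, (hpd i).eq_of_nhds, (hpd j).eq_of_nhds]
  have h2 : ∀ i j, secondForm u x i j = secondForm v x i j := fun i j => by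
    unfold secondForm
    rw [(hpd j).fderiv_eq]
    congr 2
    rw [h.fderiv_eq]
  simp only [meanCurvature, h1, h2]

/-- The base of a minimal cylinder is minimal. -/
theorem meanCurvature_eq_zero_of_cylinder {u : Euc (k + 1) → Euc n}
    {ψ : Euc k × ℝ → Euc (k + 1)} {g : Euc k → Euc n} {d : Euc n} {z : Euc k × ℝ} (hd : d ≠ 0)
    (hu : ContDiffAt ℝ ∞ u (ψ z)) (hψ : ContDiffAt ℝ ∞ ψ z) (hg : ContDiffAt ℝ ∞ g z.1)
    (hv : ∀ᶠ w in 𝓝 z, u (ψ w) = g w.1 + w.2 • d)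
    (hsurj : Function.Surjective (fderiv ℝ ψ z)) (hinj : Function.Injective (fderiv ℝ g z.1))
    (hgd : ∀ᶠ y in 𝓝 z.1, ⟪d, g y⟫ = 0) (hmin : meanCurvature u (ψ z) = 0) :
    meanCurvature g z.1 = 0 := by
  have hu1 : ∀ᶠ x in 𝓝 (ψ z), DifferentiableAt ℝ u x :=
    ((hu.of_le (by simp : (1 : ℕ∞ω) ≤ ∞)).eventually (by simp)).mono
      fun x hx => hx.differentiableAt (by simp)
  have hψ1 : ∀ᶠ w in 𝓝 z, DifferentiableAt ℝ ψ w :=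
    ((hψ.of_le (by simp : (1 : ℕ∞ω) ≤ ∞)).eventually (by simp)).mono
      fun x hx => hx.differentiableAt (by simp)
  have hg1 : ∀ᶠ y in 𝓝 z.1, DifferentiableAt ℝ g y :=
    ((hg.of_le (by simp : (1 : ℕ∞ω) ≤ ∞)).eventually (by simp)).mono
      fun x hx => hx.differentiableAt (by simp)
  have hu2 : DifferentiableAt ℝ (fderiv ℝ u) (ψ z) :=
    (hu.fderiv_right (m := ∞) (by simp)).differentiableAt (by simp)
  have hψ2 : DifferentiableAt ℝ (fderiv ℝ ψ) z :=
    (hψ.fderiv_right (m := ∞) (by simp)).differentiableAt (by simp)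
  have hg2 : DifferentiableAt ℝ (fderiv ℝ g) z.1 :=
    (hg.fderiv_right (m := ∞) (by simp)).differentiableAt (by simp)
  have hev1 : ∀ᶠ w in 𝓝 z, ∀ Z : Euc k × ℝ,
      fderiv ℝ u (ψ w) (fderiv ℝ ψ w Z) = fderiv ℝ g w.1 Z.1 + Z.2 • d := by
    filter_upwards [hv.eventually_nhds, hψ.continuousAt.eventually hu1, hψ1,
      continuous_fst.continuousAt.eventually hg1] with w hw huw hψw hgw Z
    have h1 : HasFDerivAt (fun w => u (ψ w)) ((fderiv ℝ u (ψ w)).comp (fderiv ℝ ψ w)) w :=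
      huw.hasFDerivAt.comp w hψw.hasFDerivAt
    have h2 : HasFDerivAt (fun w : Euc k × ℝ => g w.1 + w.2 • d)
        ((fderiv ℝ g w.1).comp (ContinuousLinearMap.fst ℝ (Euc k) ℝ) +
          (ContinuousLinearMap.snd ℝ (Euc k) ℝ).smulRight d) w :=
      (hgw.hasFDerivAt.comp w hasFDerivAt_fst).add (hasFDerivAt_snd.smul_const d)
    have h3 := DFunLike.congr_fun (h1.unique (h2.congr_of_eventuallyEq hw)) Z
    simpa using h3
  have hfirst := hev1.self_of_nhds
  -- The term with the second derivative of `ψ` is tangent to `u`, so it disappears once paired with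
  -- a normal vector.
  have hsecond : ∀ Z : Euc k × ℝ,
      fderiv ℝ (fderiv ℝ u) (ψ z) (fderiv ℝ ψ z Z) (fderiv ℝ ψ z Z) +
        fderiv ℝ u (ψ z) (fderiv ℝ (fderiv ℝ ψ) z Z Z) =
      fderiv ℝ (fderiv ℝ g) z.1 Z.1 Z.1 := by
    intro Z
    have hψ0 : HasFDerivAt ψ (fderiv ℝ ψ z) z := hψ1.self_of_nhds.hasFDerivAt
    have h1 : HasFDerivAt (fun w => fderiv ℝ u (ψ w))
        ((fderiv ℝ (fderiv ℝ u) (ψ z)).comp (fderiv ℝ ψ z)) z :=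
      hu2.hasFDerivAt.comp z hψ0
    have h2 := h1.clm_apply (hψ2.hasFDerivAt.clm_apply (hasFDerivAt_const Z z))
    have h3 : HasFDerivAt (fun w : Euc k × ℝ => fderiv ℝ g w.1)
        ((fderiv ℝ (fderiv ℝ g) z.1).comp (ContinuousLinearMap.fst ℝ (Euc k) ℝ)) z :=
      hg2.hasFDerivAt.comp z hasFDerivAt_fst
    have h4 := (h3.clm_apply (hasFDerivAt_const Z.1 z)).add_const (Z.2 • d)
    have h5 := DFunLike.congr_fun
      (h2.unique (h4.congr_of_eventuallyEq (hev1.mono fun w hw => hw Z))) Z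
    simp at h5
    rw [← h5, add_comm]
  have hgd1 : ∀ᶠ y in 𝓝 z.1, ∀ Y, ⟪d, fderiv ℝ g y Y⟫ = 0 := by
    filter_upwards [hgd.eventually_nhds, hg1] with y hy hgy Y
    have h1 := ((innerSL ℝ d).hasFDerivAt.comp y hgy.hasFDerivAt).unique
      ((hasFDerivAt_const (0 : ℝ) y).congr_of_eventuallyEq hy)
    exact DFunLike.congr_fun h1 Y
  have hgd2 : ∀ Y Z, ⟪d, fderiv ℝ (fderiv ℝ g) z.1 Z Y⟫ = 0 := by
    intro Y Z
    have h1 := ((innerSL ℝ d).hasFDerivAt.comp z.1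
      (hg2.hasFDerivAt.clm_apply (hasFDerivAt_const Y z.1))).unique
      ((hasFDerivAt_const (0 : ℝ) z.1).congr_of_eventuallyEq (hgd1.mono fun y hy => hy Y))
    have h2 := DFunLike.congr_fun h1 Z
    simpa using h2
  obtain ⟨Y, -, hY, -, -⟩ := exists_diagonalizing_frame (N := 0) hinj (by simp)
  set H := meanCurvature g z.1 with hH
  have hHg : ∀ X, ⟪fderiv ℝ g z.1 X, H⟫ = 0 := fun X => meanCurvature_orthogonal X
  -- Since `g` stays in the hyperplane orthogonal to `d`, so do its second derivatives. Thus `H` is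
  -- normal to the whole cylinder and can be tested against its mean curvature.
  have hHd : ⟪d, H⟫ = 0 := by
    rw [real_inner_comm, hH, inner_meanCurvature_of_orthonormal hg2
      (fun X => by rw [real_inner_comm]; exact hgd1.self_of_nhds X) hY]
    exact Finset.sum_eq_zero fun i _ => by rw [real_inner_comm, hgd2]
  have hHu : ∀ X, ⟪fderiv ℝ u (ψ z) X, H⟫ = 0 := by
    intro X
    obtain ⟨Z, rfl⟩ := hsurj X
    rw [hfirst, inner_add_left, hHg, inner_smul_left, hHd]
    simp
  have hsecond' : ∀ Z : Euc k × ℝ,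
      ⟪fderiv ℝ (fderiv ℝ u) (ψ z) (fderiv ℝ ψ z Z) (fderiv ℝ ψ z Z), H⟫ =
        ⟪fderiv ℝ (fderiv ℝ g) z.1 Z.1 Z.1, H⟫ := by
    intro Z
    rw [← hsecond, inner_add_left, hHu, add_zero]
  -- The images are `d / ‖d‖` and an orthonormal tangent frame of `g`. The first vector contributes
  -- no second derivative, so the trace for `u` reduces to that for `g`, giving `⟪H, H⟫ = 0`.
  let Z : Fin (k + 1) → Euc k × ℝ := Fin.cons (0, ‖d‖⁻¹) fun i => (Y i, 0)
  have hd' : ‖d‖ ≠ 0 := norm_ne_zero_iff.2 hd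
  have hX : Orthonormal ℝ fun i => fderiv ℝ u (ψ z) (fderiv ℝ ψ z (Z i)) := by
    rw [orthonormal_iff_ite]
    intro i j
    rw [hfirst, hfirst]
    have hgd0 := hgd1.self_of_nhds
    refine Fin.cases ?_ (fun i => ?_) i <;> refine Fin.cases ?_ (fun j => ?_) j
    · simp only [Z, Fin.cons_zero, map_zero, zero_add, inner_smul_left, inner_smul_right,
        real_inner_self_eq_norm_sq]
      simp
      field_simp
    · simp [Z, inner_smul_left, hgd0, (Fin.succ_ne_zero j).symm]
    · simp [Z, inner_smul_right, real_inner_comm, hgd0]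
    · simpa [Z] using orthonormal_iff_ite.1 hY i j
  have hsum := inner_meanCurvature_of_orthonormal hu2 hHu hX
  rw [hmin, inner_zero_left, Fin.sum_univ_succ] at hsum
  simp only [hsecond'] at hsum
  rw [← inner_self_eq_zero (𝕜 := ℝ)]
  conv_lhs => rw [hH]
  rw [inner_meanCurvature_of_orthonormal hg2 hHg hY]
  simpa [Z] using hsum.symm

/-- The image of a parametrization with a continuous left inverse is a minimal patch. -/
theorem isMinimalPatch_image {g : Euc k → Euc n} {W : Set (Euc k)} (hW : IsOpen W)
    (hg : ContDiffOn ℝ ∞ g W) (hinj : ∀ y ∈ W, Function.Injective (fderiv ℝ g y))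
    (hemb : IsEmbedding (W.domRestrict g)) (hmin : ∀ y ∈ W, meanCurvature g y = 0) :
    IsMinimalPatch k (g '' W) := by
  let W' : Opens (Euc k) := ⟨W, hW⟩
  refine ⟨W', fun y => g y, ⟨?_, ?_⟩, hemb, ?_, ?_⟩
  · exact (contMDiffOn_iff_contDiffOn.2 hg).comp_contMDiff contMDiff_subtype_val fun y => y.2
  · intro y
    have : IsManifold (𝓡 k) 1 W' := inferInstance
    have hbij := (mdifferentiable_chart (I := 𝓡 k) y).mfderiv_bijective (mem_chart_source (Euc k) y)
    let D : Euc k →L[ℝ] Euc n := fderiv ℝ g (y : Euc k)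
    have h1 : HasMFDerivAt (𝓡 k) 𝓘(ℝ, Euc n) g (chartAt (Euc k) y y) D :=
      ((hg.contDiffAt (hW.mem_nhds y.2)).differentiableAt (by simp)).hasFDerivAt.hasMFDerivAt
    have h2 := h1.comp y ((mdifferentiable_chart (I := 𝓡 k) y).mdifferentiableAt
      (mem_chart_source (Euc k) y)).hasMFDerivAt
    have h3 : differential k (fun y : W' => g y) y = _ := h2.mfderiv
    rw [h3]
    exact (hinj y y.2).comp hbij.1
  · intro e he x hx
    -- Charts of an open subset of `ℝᵏ` are restrictions of the identity, so in each of them the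
    -- patch is locally `g` itself.
    obtain ⟨y, hy⟩ : ∃ y : W', e = (chartAt (Euc k) (y : Euc k)).subtypeRestr ⟨y⟩ := by
      simpa [atlas, ChartedSpace.atlas, eq_comm] using he
    have hval : ∀ x' ∈ e.target, (e.symm x' : Euc k) = x' := by
      intro x' hx'
      have h := e.right_inv hx'
      subst hy
      exact h
    have heq : (fun y : W' => g y) ∘ e.symm =ᶠ[𝓝 x] g := by
      filter_upwards [e.open_target.mem_nhds hx] with x' hx'
      exact congrArg g (hval x' hx')
    rw [meanCurvature_congr heq]
    refine hmin x ?_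
    rw [← hval x hx]
    exact (e.symm x).2
  · ext q
    constructor
    · rintro ⟨y, rfl⟩
      exact ⟨y, y.2, rfl⟩
    · rintro ⟨y, hy, rfl⟩
      exact ⟨⟨y, hy⟩, rfl⟩

end CylinderMeanCurvature

/-! ### Product coordinates on a submanifold tangent to a fixed direction. -/

section CylinderChart

variable {k n : ℕ}

/-- Linear coordinates adapted to a subspace (the range of `A`) and a direction `d` in it. -/
theorem exists_adapted_projection {A : Euc (k + 1) →L[ℝ] Euc n} (hA : Function.Injective A)
    {d : Euc n} (hd : d ≠ 0) (hdA : ∃ X, A X = d) :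
    ∃ P : Euc n →L[ℝ] Euc k × ℝ, P d = (0, 1) ∧ (∀ q, (P q).2 = ⟪d, q⟫ / ‖d‖ ^ 2) ∧
      Function.Injective fun X => P (A X) := by
  let R := LinearMap.range A.toLinearMap
  -- The orthogonal complement of `d` inside the tangent space supplies the `k` base coordinates;
  -- the last coordinate is normalized so that `d` has height `1`.
  let K := (ℝ ∙ d)ᗮ ⊓ R
  have hdR : d ∈ R := hdA
  have hRfin : Module.finrank ℝ R = k + 1 := by
    rw [LinearMap.finrank_range_of_inj hA, finrank_euclideanSpace_fin]
  have hKfin : Module.finrank ℝ K = k := by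
    have := Submodule.finrank_add_inf_finrank_orthogonal (K₁ := ℝ ∙ d) (K₂ := R)
      ((Submodule.span_singleton_le_iff_mem d R).2 hdR)
    rw [finrank_span_singleton hd, hRfin] at this
    change Module.finrank ℝ ((ℝ ∙ d)ᗮ ⊓ R : Submodule ℝ (Euc n)) = k
    omega
  let b : K ≃ₗᵢ[ℝ] Euc k := ((stdOrthonormalBasis ℝ K).reindex (finCongr hKfin)).repr
  let P : Euc n →L[ℝ] Euc k × ℝ :=
    ((b : K →L[ℝ] Euc k).comp K.orthogonalProjectionOnto).prod ((‖d‖ ^ 2)⁻¹ • innerSL ℝ d)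
  have hP1 : ∀ q, (P q).1 = b (K.orthogonalProjectionOnto q) := fun q => rfl
  have hP2 : ∀ q, (P q).2 = ⟪d, q⟫ / ‖d‖ ^ 2 := fun q => by
    simp [P, div_eq_inv_mul]
  have hd' : ‖d‖ ≠ 0 := norm_ne_zero_iff.2 hd
  refine ⟨P, ?_, hP2, ?_⟩
  · ext1
    · rw [hP1, Submodule.orthogonalProjectionOnto_eq_zero_iff.2, map_zero]
      rw [Submodule.mem_orthogonal']
      intro q hq
      exact Submodule.mem_orthogonal_singleton_iff_inner_right.1 hq.1
    · rw [hP2, real_inner_self_eq_norm_sq]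
      exact div_self (pow_ne_zero 2 hd')
  · have hker : ∀ X, P (A X) = 0 → X = 0 := by
      intro X hX
      have h1 : K.orthogonalProjectionOnto (A X) = 0 := by
        rw [← b.map_eq_zero_iff, ← hP1, hX]
        rfl
      have h2 : ⟪d, A X⟫ = 0 := by
        have := hP2 (A X)
        rw [hX] at this
        simpa [hd'] using this.symm
      have h3 : A X ∈ K := ⟨Submodule.mem_orthogonal_singleton_iff_inner_right.2 h2, ⟨X, rfl⟩⟩
      have h4 : ⟪A X, A X⟫ = 0 :=
        (Submodule.mem_orthogonal _ _).1 (Submodule.orthogonalProjectionOnto_eq_zero_iff.1 h1) _ h3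
      exact hA (by rw [inner_self_eq_zero.1 h4, map_zero])
    intro X Y hXY
    refine sub_eq_zero.1 (hker _ ?_)
    rw [map_sub, map_sub]
    exact sub_eq_zero.2 hXY

variable {u : Euc (k + 1) → Euc n} {Ω : Set (Euc (k + 1))} {d : Euc n}

/-- Local coordinates on an immersed submanifold given by a linear map of the ambient space. -/
theorem exists_linear_chart (hΩ : IsOpen Ω) (hu : ContDiffOn ℝ ∞ u Ω) {x₀ : Euc (k + 1)}
    (hx₀ : x₀ ∈ Ω) {P : Euc n →L[ℝ] Euc k × ℝ}
    (hP : Function.Injective fun X => P (fderiv ℝ u x₀ X)) :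
    ∃ (Φ : OpenPartialHomeomorph (Euc (k + 1)) (Euc k × ℝ)) (y₀ : Euc k) (s₀ r : ℝ),
      x₀ ∈ Φ.source ∧ Φ.source ⊆ Ω ∧ Φ.target = Metric.ball y₀ r ×ˢ Metric.ball s₀ r ∧ 0 < r ∧
      (∀ x ∈ Φ.source, Φ x = P (u x)) ∧ (∀ z ∈ Φ.target, ContDiffAt ℝ ∞ Φ.symm z) := by
  let Φ₀ : Euc (k + 1) → Euc k × ℝ := fun x => P (u x)
  have hΦ₀ : ContDiffOn ℝ ∞ Φ₀ Ω := P.contDiff.comp_contDiffOn hu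
  have hder : ∀ x ∈ Ω, HasFDerivAt Φ₀ (P.comp (fderiv ℝ u x)) x := fun x hx =>
    P.hasFDerivAt.comp x
      ((hu.contDiffAt (hΩ.mem_nhds hx)).differentiableAt (by simp)).hasFDerivAt
  let e₀ : Euc (k + 1) ≃L[ℝ] Euc k × ℝ :=
    (LinearEquiv.ofInjectiveOfFinrankEq (P.comp (fderiv ℝ u x₀)).toLinearMap hP
      (by simp)).toContinuousLinearEquiv
  have he₀ : (e₀ : Euc (k + 1) →L[ℝ] Euc k × ℝ) = P.comp (fderiv ℝ u x₀) := by
    ext1 X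
    rfl
  -- Restricting to the open set where the derivative is invertible makes the inverse chart smooth
  -- at every point of its target.
  let S : Set (Euc (k + 1)) := Ω ∩ (fun x => P.comp (fderiv ℝ u x)) ⁻¹'
    range ((↑) : (Euc (k + 1) ≃L[ℝ] Euc k × ℝ) → (Euc (k + 1) →L[ℝ] Euc k × ℝ))
  have hS : IsOpen S := by
    refine ContinuousOn.isOpen_inter_preimage ?_ hΩ ContinuousLinearEquiv.isOpen
    exact continuousOn_const.clm_comp (hu.fderiv_of_isOpen hΩ (m := ∞) (by simp)).continuousOn
  have hx₀S : x₀ ∈ S := ⟨hx₀, e₀, he₀⟩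
  have hc₀ : ContDiffAt ℝ ∞ Φ₀ x₀ := hΦ₀.contDiffAt (hΩ.mem_nhds hx₀)
  have hd₀ : HasFDerivAt Φ₀ (e₀ : Euc (k + 1) →L[ℝ] Euc k × ℝ) x₀ := by
    rw [he₀]; exact hder x₀ hx₀
  let Φ₁ := (hc₀.toOpenPartialHomeomorph Φ₀ hd₀ (by simp)).restrOpen S hS
  have hΦ₁ : ∀ x, Φ₁ x = P (u x) := fun x => rfl
  have hΦ₁S : Φ₁.source ⊆ S := fun x hx => hx.2
  have hx₀Φ₁ : x₀ ∈ Φ₁.source :=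
    ⟨hc₀.mem_toOpenPartialHomeomorph_source hd₀ (by simp), hx₀S⟩
  obtain ⟨r, hr, hball⟩ := Metric.isOpen_iff.1 Φ₁.open_target _ (Φ₁.map_source hx₀Φ₁)
  -- In the sup metric a ball of the product is a product of balls, so this shrinks the target to a
  -- product.
  let Φ := (Φ₁.symm.restrOpen (Metric.ball (Φ₁ x₀) r) Metric.isOpen_ball).symm
  have hΦtarget : Φ.target = Metric.ball (Φ₁ x₀) r := inter_eq_right.2 hball
  have hΦsource : Φ.source ⊆ Φ₁.source := fun x hx => by
    have h1 : Φ.symm (Φ x) ∈ Φ₁.source := Φ₁.map_target (hball (hΦtarget ▸ Φ.map_source hx))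
    rwa [Φ.left_inv hx] at h1
  refine ⟨Φ, (Φ₁ x₀).1, (Φ₁ x₀).2, r, ?_, ?_, ?_, hr, ?_, ?_⟩
  · have h1 : Φ.symm (Φ₁ x₀) ∈ Φ.source :=
      Φ.map_target (hΦtarget ▸ Metric.mem_ball_self hr)
    have h2 : Φ.symm (Φ₁ x₀) = x₀ := Φ₁.left_inv hx₀Φ₁
    rwa [h2] at h1
  · exact fun x hx => (hΦ₁S (hΦsource hx)).1
  · rw [hΦtarget, ball_prod_same]
  · exact fun x hx => rfl
  · intro z hz
    obtain ⟨hzΩ, e, he⟩ := hΦ₁S (hΦsource (Φ.map_target hz))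
    refine Φ.contDiffAt_symm (f₀' := e) hz ?_ (hΦ₀.contDiffAt (hΩ.mem_nhds hzΩ))
    rw [he]
    exact hder _ hzΩ

/-- An immersed submanifold tangent to `d` at every point is locally a cylinder. -/
theorem exists_cylinder_chart (hΩ : IsOpen Ω) (hu : ContDiffOn ℝ ∞ u Ω)
    (hinj : ∀ x ∈ Ω, Function.Injective (fderiv ℝ u x)) (hd : d ≠ 0)
    (hdu : ∀ x ∈ Ω, ∃ X, fderiv ℝ u x X = d) {x₀ : Euc (k + 1)} (hx₀ : x₀ ∈ Ω) :
    ∃ (Φ : OpenPartialHomeomorph (Euc (k + 1)) (Euc k × ℝ)) (P : Euc n →L[ℝ] Euc k × ℝ)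
      (W : Set (Euc k)) (a b : ℝ) (g : Euc k → Euc n),
      x₀ ∈ Φ.source ∧ Φ.source ⊆ Ω ∧ Φ.target = W ×ˢ Ioo a b ∧ a < b ∧ IsOpen W ∧
      (∀ x ∈ Φ.source, Φ x = P (u x)) ∧ (∀ z ∈ Φ.target, ContDiffAt ℝ ∞ Φ.symm z) ∧
      (∀ z ∈ Φ.target, Function.Surjective (fderiv ℝ Φ.symm z)) ∧
      ContDiffOn ℝ ∞ g W ∧ (∀ z ∈ Φ.target, u (Φ.symm z) = g z.1 + z.2 • d) ∧
      (∀ y ∈ W, ⟪d, g y⟫ = 0) ∧ (∀ y ∈ W, (P (g y)).1 = y) := by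
  obtain ⟨P, hPd, hP2, hPinj⟩ := exists_adapted_projection (hinj x₀ hx₀) hd (hdu x₀ hx₀)
  obtain ⟨Φ, y₀, s₀, r, hx₀Φ, hΦΩ, hΦt, hr, hΦ, hΦs⟩ := exists_linear_chart hΩ hu hx₀ hPinj
  have hmem : ∀ {y s}, y ∈ Metric.ball y₀ r → s ∈ Metric.ball s₀ r → (y, s) ∈ Φ.target := by
    intro y s hy hs
    rw [hΦt]
    exact ⟨hy, hs⟩
  have hs₀ : s₀ ∈ Metric.ball s₀ r := Metric.mem_ball_self hr
  have hd' : ‖d‖ ≠ 0 := norm_ne_zero_iff.2 hd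
  have hsymm : ∀ z ∈ Φ.target, HasFDerivAt Φ.symm (fderiv ℝ Φ.symm z) z := fun z hz =>
    ((hΦs z hz).differentiableAt (by simp)).hasFDerivAt
  have hud : ∀ x ∈ Ω, HasFDerivAt u (fderiv ℝ u x) x := fun x hx =>
    ((hu.contDiffAt (hΩ.mem_nhds hx)).differentiableAt (by simp)).hasFDerivAt
  have hderΦ : ∀ x ∈ Φ.source, HasFDerivAt Φ (P.comp (fderiv ℝ u x)) x := fun x hx =>
    (P.hasFDerivAt.comp x (hud x (hΦΩ hx))).congr_of_eventuallyEq
      (by filter_upwards [Φ.open_source.mem_nhds hx] with y hy using hΦ y hy)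
  have hinv : ∀ z ∈ Φ.target, ∀ X,
      fderiv ℝ Φ.symm z (P (fderiv ℝ u (Φ.symm z) X)) = X := by
    intro z hz X
    have hx := Φ.map_target hz
    have h0 : HasFDerivAt Φ.symm (fderiv ℝ Φ.symm z) (Φ (Φ.symm z)) := by
      rw [Φ.right_inv hz]; exact hsymm z hz
    have h1 := (h0.comp (Φ.symm z) (hderΦ _ hx)).unique
      ((hasFDerivAt_id (Φ.symm z)).congr_of_eventuallyEq
        (by filter_upwards [Φ.open_source.mem_nhds hx] with y hy using Φ.left_inv hy))
    exact DFunLike.congr_fun h1 X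
  -- The slice at height `s₀`, translated along `d` into the hyperplane of height `0`.
  let g : Euc k → Euc n := fun y => u (Φ.symm (y, s₀)) - s₀ • d
  have hline : ∀ z ∈ Φ.target, u (Φ.symm z) = g z.1 + z.2 • d := by
    rintro ⟨y, s⟩ hz
    have hz' := hz
    rw [hΦt] at hz'
    have h1 := eq_of_hasDerivAt_zero (φ := fun t => u (Φ.symm (y, t)) - t • d) (fun t ht => ?_)
      hs₀ hz'.2
    · simp only [g]
      rw [← h1, sub_add_cancel]
    · have hyt := hmem hz'.1 ht
      have hx := hΦΩ (Φ.map_target hyt)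
      obtain ⟨X, hX⟩ := hdu _ hx
      have h2 : HasDerivAt (fun t : ℝ => (y, t)) (0, 1) t :=
        (hasDerivAt_const t y).prodMk (hasDerivAt_id t)
      have h3 := ((hud _ hx).comp_hasDerivAt t ((hsymm _ hyt).comp_hasDerivAt t h2)).sub
        ((hasDerivAt_id t).smul_const d)
      -- Since `P d = (0, 1)`, the height coordinate direction is mapped by `du` to `d`.
      have h4 : fderiv ℝ Φ.symm (y, t) (0, 1) = X := by
        rw [← hPd, ← hX]
        exact hinv _ hyt X
      rw [h4, hX, one_smul, sub_self] at h3
      exact h3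
  have hPg : ∀ y ∈ Metric.ball y₀ r, P (g y) = (y, 0) := by
    intro y hy
    have h1 := hmem hy hs₀
    have h2 := hΦ _ (Φ.map_target h1)
    rw [Φ.right_inv h1] at h2
    simp only [g, map_sub, map_smul, ← h2, hPd]
    ext1 <;> simp
  refine ⟨Φ, P, Metric.ball y₀ r, s₀ - r, s₀ + r, g, hx₀Φ, hΦΩ, ?_, by linarith,
    Metric.isOpen_ball, hΦ, hΦs, fun z hz X => ⟨_, hinv z hz X⟩, ?_, hline, ?_, ?_⟩
  · rw [hΦt, Real.ball_eq_Ioo]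
  · intro y hy
    have h1 := hmem hy hs₀
    have h2 : ContDiffAt ℝ ∞ (fun y : Euc k => (y, s₀)) y := contDiffAt_id.prodMk contDiffAt_const
    have h3 := (hu.contDiffAt (hΩ.mem_nhds (hΦΩ (Φ.map_target h1)))).comp y ((hΦs _ h1).comp y h2)
    exact (h3.sub contDiffAt_const).contDiffWithinAt
  · intro y hy
    have h1 := hP2 (g y)
    rw [hPg y hy] at h1
    simpa [hd'] using h1.symm
  · intro y hy
    rw [hPg y hy]

end CylinderChart

/-- A minimal immersed submanifold tangent to `d` at every point is locally a cylinder over a minimal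
submanifold. -/
theorem isCylinderOverMinimal_of_mem_tangentPlane {m n : ℕ} {M : Type*} [TopologicalSpace M]
    [ChartedSpace (Euc m) M] [IsManifold (𝓡 m) ∞ M] [Nonempty M] {f : M → Euc n} {d : Euc n}
    (hd : d ≠ 0) (hf : IsSmoothImmersion m f) (hmin : IsMinimal m f)
    (htan : ∀ p : M, d ∈ tangentPlane m f p) : IsCylinderOverMinimal m f d := by
  obtain ⟨k, rfl⟩ : ∃ k, m = k + 1 := by
    refine Nat.exists_eq_succ_of_ne_zero ?_
    rintro rfl
    obtain ⟨X, hX⟩ := htan (Classical.arbitrary M)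
    have hX0 : X = 0 := Subsingleton.elim (α := Euc 0) X 0
    rw [hX0, map_zero] at hX
    exact hd hX.symm
  refine ⟨k, rfl, fun p => ?_⟩
  set e := chartAt (Euc (k + 1)) p with he
  have hu := hf.contDiffOn_chart p
  have hinj : ∀ x ∈ e.target, Function.Injective (fderiv ℝ (f ∘ e.symm) x) :=
    fun x hx => hf.injective_fderiv_chart p hx
  have hp := mem_chart_source (Euc (k + 1)) p
  obtain ⟨Φ, P, W, a, b, g, hpΦ, hΦe, hΦt, hab, hW, hΦ, hΦs, hΦsurj, hg, hline, hgd, hPg⟩ :=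
    exists_cylinder_chart e.open_target hu hinj hd
      (fun x hx => by
        have h := htan (e.symm x)
        rw [← hf.range_fderiv_chart p hx] at h
        exact h) (e.map_source hp)
  have hmem : ∀ {y s}, y ∈ W → s ∈ Ioo a b → (y, s) ∈ Φ.target := by
    intro y s hy hs
    rw [hΦt]
    exact ⟨hy, hs⟩
  let Ψ := e.trans Φ
  have hΨsource : ∀ {x}, x ∈ Ψ.source ↔ x ∈ e.source ∧ e x ∈ Φ.source := by
    intro x
    rw [OpenPartialHomeomorph.trans_source]
    rfl
  have hinjg : ∀ y ∈ W, Function.Injective (fderiv ℝ g y) := by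
    intro y hy
    have h1 := ((hg.contDiffAt (hW.mem_nhds hy)).differentiableAt (by simp)).hasFDerivAt
    have h2 := (((ContinuousLinearMap.fst ℝ (Euc k) ℝ).comp P).hasFDerivAt.comp y h1).unique
      ((hasFDerivAt_id y).congr_of_eventuallyEq
        (by filter_upwards [hW.mem_nhds hy] with z hz using hPg z hz))
    exact Function.LeftInverse.injective (g := (ContinuousLinearMap.fst ℝ (Euc k) ℝ).comp P)
      fun X => DFunLike.congr_fun h2 X
  refine ⟨⟨Ψ.source, Ψ.open_source⟩, g '' W, a, b, hΨsource.2 ⟨hp, hpΦ⟩, ?_,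
    isMinimalPatch_image hW hg hinjg ?_ ?_, ?_, ?_⟩
  -- Composing `f` with the linear map `P` gives the chart `Ψ`, a homeomorphism onto its image.
  · refine IsEmbedding.of_comp (hf.1.continuous.comp continuous_subtype_val) P.continuous ?_
    have h1 : (P ∘ fun x : (⟨Ψ.source, Ψ.open_source⟩ : Opens M) => f x) =
        Ψ.source.domRestrict Ψ := by
      funext x
      obtain ⟨hx1, hx2⟩ := hΨsource.1 x.2
      have h2 : Φ (e x) = P (f (e.symm (e x))) := hΦ _ hx2
      rw [e.left_inv hx1] at h2
      exact h2.symm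
    rw [h1]
    exact Ψ.isOpenEmbedding_restrict.isEmbedding
  · refine IsEmbedding.of_comp (g := fun q => (P q).1) hg.continuousOn.domRestrict
      (continuous_fst.comp P.continuous) ?_
    have h1 : ((fun q => (P q).1) ∘ W.domRestrict g) = Subtype.val := by
      funext y
      exact hPg y y.2
    rw [h1]
    exact IsEmbedding.subtypeVal
  · intro y hy
    -- Any height in the interval would do; the midpoint is a convenient one.
    have hz := hmem hy (⟨by linarith, by linarith⟩ : (a + b) / 2 ∈ Ioo a b)
    have hx := hΦe (Φ.map_target hz)
    exact meanCurvature_eq_zero_of_cylinder (z := (y, (a + b) / 2)) hd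
      (hu.contDiffAt (e.open_target.mem_nhds hx)) (hΦs _ hz) (hg.contDiffAt (hW.mem_nhds hy))
      (by filter_upwards [Φ.open_target.mem_nhds hz] with w hw using hline w hw) (hΦsurj _ hz)
      (hinjg y hy) (by filter_upwards [hW.mem_nhds hy] with w hw using hgd w hw)
      (hmin e (chart_mem_atlas _ p) _ hx)
  · rintro _ ⟨y, hy, rfl⟩
    exact hgd y hy
  · ext q
    constructor
    · rintro ⟨x, hx, rfl⟩
      obtain ⟨hx1, hx2⟩ := hΨsource.1 hx
      have h1 := Φ.map_source hx2
      have h2 := hline _ h1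
      rw [Φ.left_inv hx2, Function.comp_apply, e.left_inv hx1] at h2
      rw [hΦt] at h1
      exact ⟨_, ⟨_, h1.1, rfl⟩, _, h1.2, h2⟩
    · rintro ⟨_, ⟨y, hy, rfl⟩, t, ht, rfl⟩
      have hz := hmem hy ht
      have hx := Φ.map_target hz
      refine ⟨e.symm (Φ.symm (y, t)), hΨsource.2 ⟨e.map_target (hΦe hx), ?_⟩, hline _ hz⟩
      rwa [e.right_inv (hΦe hx)]

end MinimalHelix

/-- A full minimal ruled helix (a connected immersed submanifold `f : M → ℝⁿ`) with respect to a
direction `d ≠ 0` has `d` tangent to it at every point; its helix angle is zero, and it is a cylinder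
over a minimal submanifold of a hyperplane orthogonal to `d`. -/
theorem mainTheorem1 {m n : ℕ} {M : Type*} [TopologicalSpace M]
    [ChartedSpace (MinimalHelix.Euc m) M] [IsManifold (𝓡 m) ∞ M] [ConnectedSpace M]
    (f : M → MinimalHelix.Euc n) (d : MinimalHelix.Euc n) (hd : d ≠ 0)
    (hf : MinimalHelix.IsSmoothImmersion m f)
    (hhelix : MinimalHelix.IsHelix m f d)
    (hruled : MinimalHelix.IsRuled m f d)
    (hmin : MinimalHelix.IsMinimal m f)
    (hfull : MinimalHelix.IsFull f) :
    (∀ p : M, d ∈ MinimalHelix.tangentPlane m f p) ∧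
      (∀ p : M, MinimalHelix.helixAngle m f d p = 0) ∧
      MinimalHelix.IsCylinderOverMinimal m f d := by
  have htan := MinimalHelix.mem_tangentPlane hf hhelix hruled hmin hfull
  refine ⟨htan, fun p => ?_, MinimalHelix.isCylinderOverMinimal_of_mem_tangentPlane hd hf hmin htan⟩
  rw [MinimalHelix.helixAngle, MinimalHelix.tangentPart,
    Submodule.starProjection_eq_self_iff.2 (htan p), InnerProductGeometry.angle_self hd]
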